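/- Let $X_1,X_2,\dots$ be i.i.d. real random variables with $0<\mathbb E|X_1|<\infty$ and $\mathbb E X_1=0$. Put $S_n=X_1+\cdots+X_n$ and $S_n^{(2)}=S_1+\cdots+S_n$, and let $$p_n^{(2)}=\mathbb P\Big(\max_{1\le k\le n}S_k^{(2)}<0\Big),\qquad \overline p_n^{(2)}=\mathbb P\Big(\max_{1\le k\le n}S_k^{(2)}\le 0\Big)\quad(n\ge1),\qquad p_0^{(2)}=\overline p_0^{(2)}=1 .$$ Let $c_1=6\sqrt{30}$; if $X_1$ is symmetric (i.e. $X_1$ and $-X_1$ have the same law), one may also take $c_1=2$. Then for all $n\ge 0$, $$\sum_{k=0}^n p_k^{(2)}\,\overline p_{n-k}^{(2)}\le c_1^2\,\frac{\mathbb E|S_{n+1}|}{\mathbb E|X_1|}\qquad\text{and}\qquad p_n^{(2)}\le c_1\sqrt{\frac{\mathbb E|S_{n+1}|}{(n+1)\,\mathbb E|X_1|}}\,.$$ Suppose moreover that $r>0$, $\theta>1/r$ and $K,L\in\mathbb R$ are such that for all $t,s>0$, $$\mathbb P(-X_1>t+s)\le K\,\mathbb P(-X_1>t)\,\mathbb P(-X_1>s)+L\,\big[\mathbb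 P(-X_1>r)\big]^{\theta(t+s)} .$$ Then for all $n\ge0$, $$\sum_{k=0}^n p_k^{(2)}\,p_{n-k}^{(2)}\ge \frac1{c_2}\,\frac{\mathbb E|S_{n+1}|}{\mathbb E|X_1|}\qquad\text{and}\qquad p_n^{(2)}\ge\frac1{4c_1c_2}\sqrt{\frac{\mathbb E|S_{n+1}|}{(n+1)\,\mathbb E|X_1|}}$$ for each of the above values of $c_1$, where $c_2\in(0,\infty)$ depends only on $K$, $L$, $\theta$, $r$ and the number $\mathbb P(-X_1>r)$ (and neither on $n$ nor otherwise on the law of $X_1$). -/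

import Mathlib

open MeasureTheory ProbabilityTheory

namespace IteratedSums

variable {Ω : Type*}

/-- The partial sum of the first `n` variables. The sequence is indexed from `0`,
so `X 0, X 1, …` are the variables usually written X₁, X₂, …. -/
def S (X : ℕ → Ω → ℝ) (n : ℕ) (ω : Ω) : ℝ :=
  ∑ i ∈ Finset.range n, X i ω

/-- The iterated partial sum `S₁ + ⋯ + Sₙ`. -/
def S2 (X : ℕ → Ω → ℝ) (n : ℕ) (ω : Ω) : ℝ :=
  ∑ k ∈ Finset.Icc 1 n, S X k ω

/-- The probability that the maximum of `S2 X k`, `1 ≤ k ≤ n`, is `< 0` (equal to `1` for `n = 0`). -/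
noncomputable def p2 [MeasurableSpace Ω] (P : Measure Ω) (X : ℕ → Ω → ℝ) (n : ℕ) : ℝ :=
  P.real {ω | ∀ k, 1 ≤ k → k ≤ n → S2 X k ω < 0}

/-- The probability that the maximum of `S2 X k`, `1 ≤ k ≤ n`, is `≤ 0` (equal to `1` for `n = 0`). -/
noncomputable def p2bar [MeasurableSpace Ω] (P : Measure Ω) (X : ℕ → Ω → ℝ) (n : ℕ) : ℝ :=
  P.real {ω | ∀ k, 1 ≤ k → k ≤ n → S2 X k ω ≤ 0}

/-- The lower tail `t ↦ P(-Y > t)` of a random variable `Y`. -/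
noncomputable def lowerTail [MeasurableSpace Ω] (P : Measure Ω) (Y : Ω → ℝ) (t : ℝ) : ℝ :=
  P.real {ω | t < -Y ω}

/-- The exponential decay assumption on the lower tail of `Y`, with constants `K, L, θ, r`. -/
def DecayAssumption [MeasurableSpace Ω] (P : Measure Ω) (Y : Ω → ℝ) (K L θ r : ℝ) : Prop :=
  0 < r ∧ 1 / r < θ ∧ ∀ t s : ℝ, 0 < t → 0 < s →
    lowerTail P Y (t + s) ≤
      K * lowerTail P Y t * lowerTail P Y s + L * lowerTail P Y r ^ (θ * (t + s))

/-- `Y` has a symmetric law: `Y` and `-Y` have the same distribution. -/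
def SymmetricLaw [MeasurableSpace Ω] (P : Measure Ω) (Y : Ω → ℝ) : Prop :=
  IdentDistrib Y (fun ω => -Y ω) P P

end IteratedSums

namespace IteratedSums

/-! ### Deterministic paths -/

/-! Tilt the walk: for real `t`, consider the sums of `t + S_l` over `l < j`, for `0 ≤ j ≤ n + 2`.
The tilts for which the maximum is attained at `j = k + 1` form an interval, and comparing with
later and earlier times separately shows that its length is the positive part of `excess`
(`argmaxSet_eq`): minus the `k`-th increment, less the `slack` of the reversed past, less the
`slack` of the future. These three quantities are independent. Different intervals share at most one
point. For `0 ≤ k ≤ n` together they cover `(0, -S_{n+1})` and lie in `[-max S, max (-S)]`, so the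
sum of the expected lengths is at least `E|S_{n+1}| / 2` and at most `E max S + E max (-S)`.

For the upper bounds, both slacks vanish with probability `p2bar k * p2bar (n - k)`, and then the
length is the negative part of an increment (`mul_lintegral_le_lintegral_excess`). A Lévy-type
inequality (`lintegral_runMax_le`) bounds the expected maxima by a multiple of `E|S_{n+1}|`.

For the lower bounds, each expected length must be bounded above by a constant times `p2 k * p2 (n -
k) * E|X_0|`. The lower tail plus an exponential, `decayFun`, is submultiplicative up to a constant,
so the expectation factors over the two slacks (`lintegral_excess_le`). Averaging the tail at the
slack gives exactly `p2 (k + 1)`, since a negative iterated path is a first step lying below minus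
the slack of the rest. The exponential part is handled by prefixing a step below `-r`
(`lintegral_expPart_slack_le`); this is where `θ > 1 / r` enters.

Monotonicity of the probabilities turns the convolution bounds into termwise ones
(`le_of_sum_mul_le`, `le_of_le_sum_mul`). -/

/-- The partial sums of a real sequence. -/
def psum (x : ℕ → ℝ) (n : ℕ) : ℝ := ∑ i ∈ Finset.range n, x i

/-- The iterated partial sums of a real sequence. -/
def psum2 (x : ℕ → ℝ) (n : ℕ) : ℝ := ∑ k ∈ Finset.Icc 1 n, psum x k

/-- The maximum of `psum2 x i / (i + 1)` over `0 ≤ i ≤ k`. -/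
noncomputable def slack (x : ℕ → ℝ) : ℕ → ℝ
  | 0 => 0
  | k + 1 => max (slack x k) (psum2 x (k + 1) / ((k : ℝ) + 2))

/-- The maximum of `psum x i` over `0 ≤ i ≤ n`. -/
noncomputable def runMax : ℕ → (ℕ → ℝ) → ℝ
  | 0, _ => 0
  | n + 1, x => max 0 (x 0 + runMax n (fun i => x (i + 1)))

/-- The injection of `ℕ` that reverses the first `k` indices. -/
def revIdx (k i : ℕ) : ℕ := if i < k then k - 1 - i else i

/-- The iterated sums of a sequence `s` tilted by `t`. -/
def tilt (s : ℕ → ℝ) (t : ℝ) (j : ℕ) : ℝ := ∑ l ∈ Finset.range j, (t + s l)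

/-- The tilts for which the iterated sums `tilt (psum x) t j`, `j ≤ n + 2`, are maximal
at `j = k + 1`. -/
def argmaxSet (x : ℕ → ℝ) (n k : ℕ) : Set ℝ :=
  {t | ∀ j ≤ n + 2, tilt (psum x) t j ≤ tilt (psum x) t (k + 1)}

@[simp] lemma psum_zero (x : ℕ → ℝ) : psum x 0 = 0 := by simp [psum]

lemma psum_succ (x : ℕ → ℝ) (n : ℕ) : psum x (n + 1) = psum x n + x n := by
  simp [psum, Finset.sum_range_succ]

lemma psum_succ_shift (x : ℕ → ℝ) (n : ℕ) :
    psum x (n + 1) = x 0 + psum (fun i => x (i + 1)) n := by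
  simp [psum, Finset.sum_range_succ', add_comm]

@[simp] lemma psum2_zero (x : ℕ → ℝ) : psum2 x 0 = 0 := by simp [psum2]

lemma psum2_succ (x : ℕ → ℝ) (n : ℕ) : psum2 x (n + 1) = psum2 x n + psum x (n + 1) := by
  simp [psum2, Finset.sum_Icc_succ_top]

lemma psum2_succ_shift (x : ℕ → ℝ) (n : ℕ) :
    psum2 x (n + 1) = ((n : ℝ) + 1) * x 0 + psum2 (fun i => x (i + 1)) n := by
  induction n with
  | zero => simp [psum2_succ, psum_succ]
  | succ n ih =>
    rw [psum2_succ, ih, psum2_succ _ n, psum_succ_shift]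
    push_cast
    ring

lemma psum_neg (x : ℕ → ℝ) (n : ℕ) : psum (fun i => -x i) n = -psum x n := by
  simp [psum]

lemma slack_nonneg (x : ℕ → ℝ) (k : ℕ) : 0 ≤ slack x k := by
  induction k with
  | zero => simp [slack]
  | succ k ih => exact ih.trans (le_max_left _ _)

/-- The weight `i + 1` is the number of times a step put in front of the path enters its iterated
sum at time `i + 1`. Dividing by it turns all the constraints into one threshold for that step. -/
lemma slack_le_iff (x : ℕ → ℝ) (k : ℕ) (a : ℝ) :
    slack x k ≤ a ↔ ∀ i ≤ k, psum2 x i ≤ ((i : ℝ) + 1) * a := by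
  induction k with
  | zero => simp [slack]
  | succ k ih =>
    have h : (0 : ℝ) < (k : ℝ) + 2 := by positivity
    rw [slack, max_le_iff, ih, div_le_iff₀ h]
    constructor
    · rintro ⟨h1, h2⟩ i hi
      rcases Nat.lt_or_ge i (k + 1) with hlt | hge
      · exact h1 i (by omega)
      · obtain rfl : i = k + 1 := by omega
        push_cast
        linarith
    · intro H
      refine ⟨fun i hi => H i (by omega), ?_⟩
      have := H (k + 1) le_rfl
      push_cast at this
      linarith

lemma slack_lt_iff (x : ℕ → ℝ) (k : ℕ) (a : ℝ) :
    slack x k < a ↔ ∀ i ≤ k, psum2 x i < ((i : ℝ) + 1) * a := by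
  induction k with
  | zero => simp [slack]
  | succ k ih =>
    have h : (0 : ℝ) < (k : ℝ) + 2 := by positivity
    rw [slack, max_lt_iff, ih, div_lt_iff₀ h]
    constructor
    · rintro ⟨h1, h2⟩ i hi
      rcases Nat.lt_or_ge i (k + 1) with hlt | hge
      · exact h1 i (by omega)
      · obtain rfl : i = k + 1 := by omega
        push_cast
        linarith
    · intro H
      refine ⟨fun i hi => H i (by omega), ?_⟩
      have := H (k + 1) le_rfl
      push_cast at this
      linarith

lemma slack_le_slack_succ (x : ℕ → ℝ) (k : ℕ) : slack x k ≤ slack x (k + 1) :=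
  le_max_left _ _

lemma slack_congr {x y : ℕ → ℝ} {k : ℕ} (h : ∀ i < k, x i = y i) : slack x k = slack y k := by
  have h2 : ∀ i ≤ k, psum2 x i = psum2 y i := fun i hi =>
    Finset.sum_congr rfl fun j hj => Finset.sum_congr rfl fun l hl => h l (by
      have := (Finset.mem_Icc.1 hj).2
      have := Finset.mem_range.1 hl
      omega)
  refine eq_of_forall_ge_iff fun a => ?_
  rw [slack_le_iff, slack_le_iff]
  exact forall₂_congr fun i hi => by rw [h2 i hi]

/-- A first step below `-r` decreases the slack of the remaining path by `r`. -/
lemma slack_succ_le {x : ℕ → ℝ} {k : ℕ} {r : ℝ} (h : r < -x 0) :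
    slack x (k + 1) ≤ max (slack (fun i => x (i + 1)) k - r) 0 := by
  set a := max (slack (fun i => x (i + 1)) k - r) 0 with ha
  have ha0 : 0 ≤ a := le_max_right _ _
  have h1 : slack (fun i => x (i + 1)) k ≤ a + r := by
    have := le_max_left (slack (fun i => x (i + 1)) k - r) 0
    rw [← ha] at this
    linarith
  rw [slack_le_iff] at h1 ⊢
  intro i hi
  rcases i with _ | i
  · simpa using ha0
  · have h2 := h1 i (by omega)
    rw [psum2_succ_shift]
    push_cast
    nlinarith [mul_le_mul_of_nonneg_left h.le (by positivity : (0 : ℝ) ≤ (i : ℝ) + 1)]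

/-- Separates the first step from the rest, so that for i.i.d. steps the event in `p2` compares two
independent variables. -/
lemma slack_shift_lt_iff (x : ℕ → ℝ) (k : ℕ) :
    slack (fun i => x (i + 1)) k < -x 0 ↔ ∀ i, 1 ≤ i → i ≤ k + 1 → psum2 x i < 0 := by
  rw [slack_lt_iff]
  constructor
  · intro h i h1 h2
    obtain ⟨i, rfl⟩ : ∃ j, i = j + 1 := ⟨i - 1, by omega⟩
    have := h i (by omega)
    rw [psum2_succ_shift]
    linarith
  · intro h i hi
    have := h (i + 1) (by omega) (by omega)
    rw [psum2_succ_shift] at this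
    linarith

lemma slack_nonpos_iff (x : ℕ → ℝ) (k : ℕ) :
    slack x k ≤ 0 ↔ ∀ i, 1 ≤ i → i ≤ k → psum2 x i ≤ 0 := by
  rw [slack_le_iff]
  constructor
  · intro h i _ hi
    simpa using h i hi
  · intro h i hi
    rcases i with _ | i
    · simp
    · simpa using h (i + 1) (by omega) hi

lemma runMax_nonneg (n : ℕ) (x : ℕ → ℝ) : 0 ≤ runMax n x := by
  cases n with
  | zero => simp [runMax]
  | succ n => exact le_max_left _ _

lemma psum_le_runMax {n : ℕ} {x : ℕ → ℝ} {l : ℕ} (h : l ≤ n) : psum x l ≤ runMax n x := by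
  induction n generalizing x l with
  | zero =>
    obtain rfl : l = 0 := by omega
    simp [runMax]
  | succ n ih =>
    rcases l with _ | l
    · simpa using runMax_nonneg _ _
    · rw [psum_succ_shift]
      exact (add_le_add_right (ih (by omega)) _).trans (le_max_right _ _)

lemma revIdx_injective (k : ℕ) : Function.Injective (revIdx k) := by
  intro i j h
  simp only [revIdx] at h
  split_ifs at h <;> omega

lemma psum_add (x : ℕ → ℝ) (k m : ℕ) :
    psum x (k + m) = psum x k + psum (fun i => x (k + i)) m := by
  simp [psum, Finset.sum_range_add]

lemma psum_revIdx (x : ℕ → ℝ) {k m : ℕ} (h : m ≤ k) :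
    psum (fun i => x (revIdx k i)) m = psum x k - psum x (k - m) := by
  induction m with
  | zero => simp
  | succ m ih =>
    rw [psum_succ, ih (by omega), revIdx, if_pos (by omega),
      show k - m = (k - 1 - m) + 1 by omega, psum_succ,
      show k - (m + 1) = k - 1 - m by omega]
    ring

/-! ### Tilted iterated sums and the location of their maximum -/

lemma tilt_succ (s : ℕ → ℝ) (t : ℝ) (j : ℕ) : tilt s t (j + 1) = tilt s t j + (t + s j) := by
  simp [tilt, Finset.sum_range_succ]

/-- Each of the `l + 1` steps after time `k + 1` contains `t + S_{k+1}`; what is left is built from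
the increments after the `k`-th alone. -/
lemma tilt_forward (x : ℕ → ℝ) (t : ℝ) (k l : ℕ) :
    tilt (psum x) t (k + 2 + l) = tilt (psum x) t (k + 1) +
      (((l : ℝ) + 1) * (t + psum x (k + 1)) + psum2 (fun i => x (k + 1 + i)) l) := by
  induction l with
  | zero => simp [tilt_succ]
  | succ l ih =>
    rw [← add_assoc, tilt_succ, ih, show k + 2 + l = k + 1 + (l + 1) by ring,
      psum_add x (k + 1), psum2_succ]
    push_cast
    ring

/-- The same decomposition read backwards from time `k + 1`, around `t + S_k`. The increment `x k`
occurs in neither remainder; it is the gap between the two reference levels. -/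
lemma tilt_backward (x : ℕ → ℝ) (t : ℝ) {k l : ℕ} (h : l ≤ k) :
    tilt (psum x) t (k - l) = tilt (psum x) t (k + 1) -
      (((l : ℝ) + 1) * (t + psum x k) - psum2 (fun i => x (revIdx k i)) l) := by
  induction l with
  | zero => simp [tilt_succ]
  | succ l ih =>
    have h1 := ih (by omega)
    rw [show k - l = (k - (l + 1)) + 1 by omega, tilt_succ] at h1
    rw [psum2_succ, psum_revIdx x h]
    push_cast
    linarith

/-- Being maximal over the earlier times gives the left endpoint, over the later times the right
one. The common shift by `S_k` cancels in the length. -/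
lemma argmaxSet_eq (x : ℕ → ℝ) {n k : ℕ} (hk : k ≤ n) :
    argmaxSet x n k = Set.Icc (slack (fun i => x (revIdx k i)) k - psum x k)
      (-x k - slack (fun i => x (k + 1 + i)) (n - k) - psum x k) := by
  ext t
  have e1 : slack (fun i => x (revIdx k i)) k - psum x k ≤ t ↔
      slack (fun i => x (revIdx k i)) k ≤ t + psum x k := sub_le_iff_le_add
  have e2 : t ≤ -x k - slack (fun i => x (k + 1 + i)) (n - k) - psum x k ↔
      slack (fun i => x (k + 1 + i)) (n - k) ≤ -(t + psum x (k + 1)) := by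
    rw [psum_succ]
    constructor <;> intro h <;> linarith
  rw [Set.mem_Icc, e1, e2, slack_le_iff, slack_le_iff]
  constructor
  · intro h
    refine ⟨fun i hi => ?_, fun i hi => ?_⟩
    · have := h (k - i) (by omega)
      rw [tilt_backward x t hi] at this
      linarith
    · have := h (k + 2 + i) (by omega)
      rw [tilt_forward] at this
      linarith
  · rintro ⟨h1, h2⟩ j hj
    rcases lt_trichotomy j (k + 1) with hlt | rfl | hgt
    · have := h1 (k - j) (by omega)
      have e := tilt_backward x t (k := k) (l := k - j) (by omega)
      rw [show k - (k - j) = j by omega] at e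
      linarith
    · exact le_rfl
    · have := h2 (j - (k + 2)) (by omega)
      have e := tilt_forward x t k (j - (k + 2))
      rw [show k + 2 + (j - (k + 2)) = j by omega] at e
      linarith

lemma volume_argmaxSet (x : ℕ → ℝ) {n k : ℕ} (hk : k ≤ n) :
    volume (argmaxSet x n k) = ENNReal.ofReal (-x k - slack (fun i => x (revIdx k i)) k -
      slack (fun i => x (k + 1 + i)) (n - k)) := by
  rw [argmaxSet_eq x hk, Real.volume_Icc]
  congr 1
  ring

lemma tilt_sub (s : ℕ → ℝ) (t t' : ℝ) (j : ℕ) : tilt s t j - tilt s t' j = j * (t - t') := by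
  simp only [tilt, ← Finset.sum_sub_distrib, add_sub_add_right_eq_sub]
  simp [mul_sub]

/-- The sum at time `j` is affine in `t` with slope `j`, so a tie between two different times
determines `t`. -/
lemma argmaxSet_inter_subsingleton (x : ℕ → ℝ) {n k k' : ℕ} (hk : k ≤ n) (hk' : k' ≤ n)
    (hne : k ≠ k') : (argmaxSet x n k ∩ argmaxSet x n k').Subsingleton := by
  rintro t ⟨h1, h2⟩ t' ⟨h3, h4⟩
  have a1 := le_antisymm (h1 (k' + 1) (by omega)) (h2 (k + 1) (by omega))
  have a2 := le_antisymm (h3 (k' + 1) (by omega)) (h4 (k + 1) (by omega))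
  have b1 := tilt_sub (psum x) t t' (k + 1)
  have b2 := tilt_sub (psum x) t t' (k' + 1)
  have h : ((k : ℝ) - k') * (t - t') = 0 := by
    push_cast at b1 b2
    linarith
  rcases mul_eq_zero.1 h with h | h
  · exact absurd (by exact_mod_cast sub_eq_zero.1 h) hne
  · linarith

/-- At a maximum at time `k + 1` the step in is nonnegative and the step out nonpositive, so `-S_k ≤
t ≤ -S_{k+1}`. The null overlaps make the lengths add up. -/
lemma sum_volume_argmaxSet_le (x : ℕ → ℝ) (n : ℕ) :
    ∑ k ∈ Finset.range (n + 1), volume (argmaxSet x n k) ≤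
      ENNReal.ofReal (runMax (n + 1) x + runMax (n + 1) (fun i => -x i)) := by
  rw [← measure_biUnion_finset₀]
  · have hsub : (⋃ k ∈ Finset.range (n + 1), argmaxSet x n k) ⊆
        Set.Icc (-runMax (n + 1) x) (runMax (n + 1) (fun i => -x i)) := by
      refine Set.iUnion₂_subset fun k hk t ht => ?_
      have hk := Finset.mem_range.1 hk
      have h1 := ht k (by omega)
      have h2 := ht (k + 2) (by omega)
      rw [tilt_succ] at h1 h2
      have h3 := psum_le_runMax (n := n + 1) (x := x) (l := k) (by omega)
      have h4 := psum_le_runMax (n := n + 1) (x := fun i => -x i) (l := k + 1) (by omega)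
      rw [psum_neg] at h4
      constructor <;> linarith
    refine (measure_mono hsub).trans ?_
    rw [Real.volume_Icc]
    exact ENNReal.ofReal_le_ofReal (by linarith)
  · intro k hk k' hk' hne
    have hk := Finset.mem_range.1 hk
    have hk' := Finset.mem_range.1 hk'
    exact (argmaxSet_inter_subsingleton x (by omega) (by omega) hne).measure_zero _
  · intro k hk
    have hk := Finset.mem_range.1 hk
    rw [argmaxSet_eq x (by omega)]
    exact measurableSet_Icc.nullMeasurableSet

/-- For `0 < t < -S_{n+1}` the first step `t` goes up and the last step `t + S_{n+1}` goes down, so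
the maximum sits at neither end. -/
lemma le_sum_volume_argmaxSet (x : ℕ → ℝ) (n : ℕ) :
    ENNReal.ofReal (-psum x (n + 1)) ≤
      ∑ k ∈ Finset.range (n + 1), volume (argmaxSet x n k) := by
  refine le_trans ?_ (measure_biUnion_finset_le _ _)
  have e : ENNReal.ofReal (-psum x (n + 1)) = volume (Set.Ioo 0 (-psum x (n + 1))) := by simp
  rw [e]
  refine measure_mono fun t ht => ?_
  obtain ⟨j, hj, hmax⟩ := Finset.exists_max_image (Finset.range (n + 3)) (tilt (psum x) t) (by simp)
  have hj := Finset.mem_range.1 hj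
  have h0 : j ≠ 0 := by
    rintro rfl
    have := hmax 1 (by simp)
    rw [tilt_succ, psum_zero] at this
    linarith [ht.1]
  have hn : j ≠ n + 2 := by
    rintro rfl
    have := hmax (n + 1) (by simp)
    rw [tilt_succ _ _ (n + 1)] at this
    linarith [ht.2]
  obtain ⟨k, rfl⟩ : ∃ k, j = k + 1 := ⟨j - 1, by omega⟩
  exact Set.mem_iUnion₂.2 ⟨k, Finset.mem_range.2 (by omega),
    fun i hi => hmax i (Finset.mem_range.2 (by omega))⟩

/-! ### Measurability of the path functionals -/

@[fun_prop] lemma measurable_psum (n : ℕ) : Measurable fun x : ℕ → ℝ => psum x n := by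
  unfold psum
  fun_prop

@[fun_prop] lemma measurable_psum2 (n : ℕ) : Measurable fun x : ℕ → ℝ => psum2 x n := by
  unfold psum2
  fun_prop

@[fun_prop] lemma measurable_slack (k : ℕ) : Measurable fun x : ℕ → ℝ => slack x k := by
  induction k with
  | zero => simp only [slack]; fun_prop
  | succ k ih => simp only [slack]; fun_prop

@[fun_prop] lemma measurable_runMax (n : ℕ) : Measurable fun x : ℕ → ℝ => runMax n x := by
  induction n with
  | zero => simp only [runMax]; fun_prop
  | succ n ih =>
    simp only [runMax]
    exact measurable_const.max ((measurable_pi_apply 0).add (ih.comp (by fun_prop)))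

end IteratedSums

namespace IteratedSums

/-! ### Independent and identically distributed sequences -/

/-- A sequence of independent, identically distributed, measurable real random variables. -/
structure IsIID {Ω : Type*} [MeasurableSpace Ω] (P : Measure Ω) (X : ℕ → Ω → ℝ) : Prop where
  measurable : ∀ i, Measurable (X i)
  indep : iIndepFun X P
  ident : ∀ i, IdentDistrib (X i) (X 0) P P

/-- The σ-algebra generated by the variables with index in `A`. -/
@[reducible] def sigmaOf {Ω : Type*} (X : ℕ → Ω → ℝ) (A : Set ℕ) : MeasurableSpace Ω :=
  ⨆ i ∈ A, MeasurableSpace.comap (X i) inferInstance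

lemma measurable_sigmaOf {Ω : Type*} {X : ℕ → Ω → ℝ} {A : Set ℕ} {i : ℕ} (hi : i ∈ A) :
    Measurable[sigmaOf X A] (X i) :=
  measurable_iff_comap_le.2 (le_iSup₂_of_le i hi le_rfl)

/-- The reversed path keeps all its coordinates from `k` on, but the slack ignores them; replacing
them by zero leaves only variables with index below `k`. -/
lemma measurable_slack_revIdx {Ω : Type*} {X : ℕ → Ω → ℝ} {A : Set ℕ} {k : ℕ}
    (hA : ∀ i < k, i ∈ A) :
    Measurable[sigmaOf X A] fun ω => slack (fun i => X (revIdx k i) ω) k := by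
  have e : (fun ω => slack (fun i => X (revIdx k i) ω) k) =
      (fun x => slack x k) ∘ fun ω i => if i < k then X (revIdx k i) ω else 0 := by
    funext ω
    exact slack_congr fun i hi => by simp [hi]
  rw [e]
  refine (measurable_slack k).comp
    (@measurable_pi_lambda _ _ _ (sigmaOf X A) _ _ fun i => ?_)
  by_cases hi : i < k
  · simp only [hi, if_true]
    refine measurable_sigmaOf (hA _ ?_)
    simp only [revIdx, hi, if_true]
    omega
  · simp only [hi, if_false]
    exact @measurable_const _ _ _ (sigmaOf X A) _

lemma measurable_slack_shift {Ω : Type*} {X : ℕ → Ω → ℝ} {A : Set ℕ} {k m : ℕ}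
    (hA : ∀ i, k ≤ i → i ∈ A) :
    Measurable[sigmaOf X A] fun ω => slack (fun i => X (k + i) ω) m :=
  (measurable_slack m).comp
    (@measurable_pi_lambda _ _ _ (sigmaOf X A) _ _ fun _ => measurable_sigmaOf (hA _ (by omega)))

namespace IsIID

variable {Ω : Type*} [MeasurableSpace Ω] {P : Measure Ω} {X Y : ℕ → Ω → ℝ}

lemma path_measurable (h : IsIID P X) : Measurable fun ω i => X i ω :=
  measurable_pi_lambda _ h.measurable

lemma precomp (h : IsIID P X) {σ : ℕ → ℕ} (hσ : Function.Injective σ) :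
    IsIID P fun i => X (σ i) :=
  ⟨fun _ => h.measurable _, h.indep.precomp hσ, fun _ => (h.ident _).trans (h.ident _).symm⟩

lemma neg (h : IsIID P X) : IsIID P fun i ω => -X i ω :=
  ⟨fun i => (h.measurable i).neg, h.indep.comp (fun _ x => -x) (fun _ => measurable_neg),
    fun i => (h.ident i).comp measurable_neg⟩

lemma path_ident [IsProbabilityMeasure P] (hX : IsIID P X) (hY : IsIID P Y)
    (h : IdentDistrib (X 0) (Y 0) P P) :
    IdentDistrib (fun ω i => X i ω) (fun ω i => Y i ω) P P := by
  refine ⟨hX.path_measurable.aemeasurable, hY.path_measurable.aemeasurable, ?_⟩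
  rw [hX.indep.map_fun_eq_infinitePi_map hX.measurable,
    hY.indep.map_fun_eq_infinitePi_map hY.measurable]
  congr 1
  funext i
  rw [(hX.ident i).map_eq, (hY.ident i).map_eq, h.map_eq]

lemma path_ident_precomp [IsProbabilityMeasure P] (h : IsIID P X) {σ : ℕ → ℕ}
    (hσ : Function.Injective σ) :
    IdentDistrib (fun ω i => X (σ i) ω) (fun ω i => X i ω) P P :=
  (h.precomp hσ).path_ident h (h.ident _)

lemma indepFun_of_disjoint {β γ : Type*} [MeasurableSpace β] [MeasurableSpace γ] (h : IsIID P X)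
    {A B : Set ℕ} (hAB : Disjoint A B) {f : Ω → β} {g : Ω → γ}
    (hf : Measurable[sigmaOf X A] f) (hg : Measurable[sigmaOf X B] g) : IndepFun f g P := by
  rw [IndepFun_iff_Indep]
  exact indep_of_indep_of_le_left (indep_of_indep_of_le_right
    (indep_iSup_of_disjoint (fun i => (h.measurable i).comap_le) h.indep.iIndep hAB)
    hg.comap_le) hf.comap_le

/-- The Markov property at time one: the first variable and the shifted path are independent,
and the shifted path has the law of the path. -/
lemma lintegral_first_step [IsProbabilityMeasure P] (h : IsIID P X)
    {f : ℝ × (ℕ → ℝ) → ENNReal} (hf : Measurable f) :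
    ∫⁻ ω, f (X 0 ω, fun i => X (i + 1) ω) ∂P =
      ∫⁻ ω, ∫⁻ ω', f (X 0 ω, fun i => X i ω') ∂P ∂P := by
  have hind : IndepFun (X 0) (fun ω i => X (i + 1) ω) P :=
    h.indepFun_of_disjoint (A := {0}) (B := Set.Ici 1)
      (by simp) (measurable_sigmaOf rfl)
      (@measurable_pi_lambda _ _ _ (sigmaOf X (Set.Ici 1)) _ _
        fun i => measurable_sigmaOf (by simp))
  have hm : Measurable fun ω i => X (i + 1) ω := measurable_pi_lambda _ fun i => h.measurable _
  have hid := h.path_ident_precomp (σ := fun i => i + 1) (add_left_injective 1)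
  have h0 := h.measurable 0
  have hp := h.path_measurable
  rw [← lintegral_map (f := f) (g := fun ω => (X 0 ω, fun i => X (i + 1) ω)) hf
      (h0.prodMk hm),
    hind.map_prod_eq_prod_map_map h0.aemeasurable hm.aemeasurable, hid.map_eq,
    lintegral_prod _ hf.aemeasurable,
    lintegral_map (f := fun a => ∫⁻ z, f (a, z) ∂(P.map fun ω i => X i ω))
      hf.lintegral_prod_right' h0]
  refine lintegral_congr fun ω => ?_
  rw [lintegral_map (by fun_prop) hp]

/-! ### Maximal inequality and monotonicity of the first absolute moments -/

/-- An integrated maximal inequality of Lévy type. -/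
lemma lintegral_runMax_le [IsProbabilityMeasure P] (h : IsIID P X) {u : ℝ} (hu : 0 ≤ u)
    {N : ℕ} (hN : ∀ m ≤ N, 1 ≤ 2 * P {ω | -u ≤ psum (fun i => X i ω) m}) (a : ℝ) :
    ∫⁻ ω, ENNReal.ofReal (runMax N (fun i => X i ω) - u - a) ∂P ≤
      2 * ∫⁻ ω, ENNReal.ofReal (psum (fun i => X i ω) N - a) ∂P := by
  have hp := h.path_measurable
  have hps : ∀ N, Measurable fun ω => psum (fun i => X i ω) N := fun N =>
    (measurable_psum N).comp hp
  induction N generalizing a with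
  | zero =>
    simp only [runMax, psum_zero, lintegral_const, measure_univ, mul_one]
    refine (ENNReal.ofReal_le_ofReal (by linarith)).trans (le_mul_of_one_le_left zero_le ?_)
    exact one_le_two
  | succ N ih =>
    have key : ∀ b : ℝ, 0 ≤ u + b →
        ∫⁻ ω, ENNReal.ofReal (runMax (N + 1) (fun i => X i ω) - u - b) ∂P ≤
          2 * ∫⁻ ω, ENNReal.ofReal (psum (fun i => X i ω) (N + 1) - b) ∂P := by
      intro b hb
      have e1 : ∀ ω, ENNReal.ofReal (runMax (N + 1) (fun i => X i ω) - u - b) =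
          ENNReal.ofReal (X 0 ω + runMax N (fun i => X (i + 1) ω) - u - b) := by
        intro ω
        simp only [runMax]
        rcases le_total 0 (X 0 ω + runMax N (fun i => X (i + 1) ω)) with h0 | h0
        · rw [max_eq_right h0]
        · rw [max_eq_left h0, ENNReal.ofReal_of_nonpos (by linarith),
            ENNReal.ofReal_of_nonpos (by linarith)]
      simp only [e1, psum_succ_shift]
      rw [h.lintegral_first_step
          (f := fun p => ENNReal.ofReal (p.1 + runMax N p.2 - u - b)) (by fun_prop),
        h.lintegral_first_step
          (f := fun p => ENNReal.ofReal (p.1 + psum p.2 N - b)) (by fun_prop),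
        ← lintegral_const_mul' _ _ (by simp)]
      refine lintegral_mono fun ω => ?_
      -- Given the first step, the level becomes `b - X 0 ω`, of arbitrary sign; hence the induction
      -- runs over all real levels.
      have := ih (fun m hm => hN m (by omega)) (b - X 0 ω)
      convert this using 4 <;> ring_nf
    rcases le_or_gt 0 (u + a) with ha | ha
    · exact key a ha
    -- For `a < -u` the integrand on the left is the maximum plus the positive constant `-u - a`.
    -- Level `-u` handles the maximum, and `hN` pays for the constant on the event where the sum is
    -- at least `-u`.
    · have h1 := key (-u) (by simp)
      have h2 := hN (N + 1) le_rfl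
      simp only [sub_neg_eq_add, sub_add_cancel] at h1
      have hS : MeasurableSet {ω | -u ≤ psum (fun i => X i ω) (N + 1)} :=
        measurableSet_le measurable_const (hps _)
      calc ∫⁻ ω, ENNReal.ofReal (runMax (N + 1) (fun i => X i ω) - u - a) ∂P
          = ∫⁻ ω, (ENNReal.ofReal (runMax (N + 1) (fun i => X i ω)) +
              ENNReal.ofReal (-u - a)) ∂P := by
            refine lintegral_congr fun ω => ?_
            rw [← ENNReal.ofReal_add (runMax_nonneg _ _) (by linarith)]
            congr 1
            ring
        _ = ∫⁻ ω, ENNReal.ofReal (runMax (N + 1) (fun i => X i ω)) ∂P +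
              ENNReal.ofReal (-u - a) * 1 := by
            rw [lintegral_add_right _ measurable_const, lintegral_const, measure_univ]
        _ ≤ 2 * ∫⁻ ω, ENNReal.ofReal (psum (fun i => X i ω) (N + 1) + u) ∂P +
              ENNReal.ofReal (-u - a) *
                (2 * P {ω | -u ≤ psum (fun i => X i ω) (N + 1)}) := by gcongr
        _ = 2 * ∫⁻ ω, (ENNReal.ofReal (psum (fun i => X i ω) (N + 1) + u) +
              {ω | -u ≤ psum (fun i => X i ω) (N + 1)}.indicator
                (fun _ => ENNReal.ofReal (-u - a)) ω) ∂P := by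
            rw [lintegral_add_right _ (measurable_const.indicator hS),
              lintegral_indicator_const hS]
            ring
        _ ≤ _ := by
            gcongr with ω
            by_cases hω : ω ∈ {ω | -u ≤ psum (fun i => X i ω) (N + 1)}
            · rw [Set.indicator_of_mem hω]
              simp only [Set.mem_ofPred_eq] at hω
              rw [← ENNReal.ofReal_add (by linarith) (by linarith)]
              exact ENNReal.ofReal_le_ofReal (by linarith)
            · rw [Set.indicator_of_notMem hω, add_zero]
              exact ENNReal.ofReal_le_ofReal (by linarith)

lemma integrable_psum (h : IsIID P X) (hint : Integrable (X 0) P) (n : ℕ) :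
    Integrable (fun ω => psum (fun i => X i ω) n) P :=
  integrable_finsetSum _ fun i _ => (h.ident i).integrable_iff.2 hint

lemma integral_psum (h : IsIID P X) (hint : Integrable (X 0) P) (h0 : ∫ ω, X 0 ω ∂P = 0)
    (n : ℕ) : ∫ ω, psum (fun i => X i ω) n ∂P = 0 := by
  unfold psum
  rw [integral_finsetSum _ fun i _ => (h.ident i).integrable_iff.2 hint]
  exact Finset.sum_eq_zero fun i _ => by rw [(h.ident i).integral_eq, h0]

/-- Jensen's inequality: integrating out an independent centred first step from `|X 0 + s|` gives at
least `|s|`. -/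
lemma integral_abs_psum_le_succ [IsProbabilityMeasure P] (h : IsIID P X)
    (hint : Integrable (X 0) P) (h0 : ∫ ω, X 0 ω ∂P = 0) (n : ℕ) :
    ∫ ω, |psum (fun i => X i ω) n| ∂P ≤ ∫ ω, |psum (fun i => X i ω) (n + 1)| ∂P := by
  have hp := h.path_measurable
  have h0m := h.measurable 0
  have hps : ∀ N, Measurable fun ω => psum (fun i => X i ω) N := fun N =>
    (measurable_psum N).comp hp
  rw [← ENNReal.ofReal_le_ofReal_iff (integral_nonneg fun _ => abs_nonneg _),
    ofReal_integral_eq_lintegral_ofReal (h.integrable_psum hint _).abs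
      (ae_of_all _ fun _ => abs_nonneg _),
    ofReal_integral_eq_lintegral_ofReal (h.integrable_psum hint _).abs
      (ae_of_all _ fun _ => abs_nonneg _)]
  simp only [psum_succ_shift]
  rw [h.lintegral_first_step (f := fun p => ENNReal.ofReal |p.1 + psum p.2 n|) (by fun_prop),
    lintegral_lintegral_swap]
  · refine lintegral_mono fun ω' => ?_
    have hi : Integrable (fun ω => X 0 ω + psum (fun i => X i ω') n) P :=
      hint.add (integrable_const _)
    have e : ∫ ω, (X 0 ω + psum (fun i => X i ω') n) ∂P = psum (fun i => X i ω') n := by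
      rw [integral_add hint (integrable_const _), h0]
      simp
    rw [← ofReal_integral_eq_lintegral_ofReal hi.abs (ae_of_all _ fun _ => abs_nonneg _)]
    refine ENNReal.ofReal_le_ofReal ?_
    conv_lhs => rw [← e]
    exact abs_integral_le_integral_abs
  · refine Measurable.aemeasurable ?_
    have := (hps n).comp (measurable_snd : Measurable (Prod.snd : Ω × Ω → Ω))
    have := h0m.comp (measurable_fst : Measurable (Prod.fst : Ω × Ω → Ω))
    simp only [Function.comp_def] at *
    simp only [Function.uncurry_def]
    fun_prop

lemma monotone_integral_abs_psum [IsProbabilityMeasure P] (h : IsIID P X)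
    (hint : Integrable (X 0) P) (h0 : ∫ ω, X 0 ω ∂P = 0) :
    Monotone fun n => ∫ ω, |psum (fun i => X i ω) n| ∂P :=
  monotone_nat_of_le_succ (h.integral_abs_psum_le_succ hint h0)

end IsIID

lemma lintegral_ofReal_of_integral_eq_zero {Ω : Type*} [MeasurableSpace Ω] {P : Measure Ω}
    {Z : Ω → ℝ} (hint : Integrable Z P) (h0 : ∫ ω, Z ω ∂P = 0) :
    ∫⁻ ω, ENNReal.ofReal (Z ω) ∂P = ENNReal.ofReal ((∫ ω, |Z ω| ∂P) / 2) := by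
  have e : ∀ ω, ENNReal.ofReal (Z ω) = ENNReal.ofReal ((|Z ω| + Z ω) / 2) := by
    intro ω
    rcases le_total 0 (Z ω) with h | h
    · rw [abs_of_nonneg h]; congr 1; ring
    · rw [abs_of_nonpos h, ENNReal.ofReal_of_nonpos h]; simp
  simp only [e]
  have hi : Integrable (fun ω => (|Z ω| + Z ω) / 2) P := (hint.abs.add hint).div_const 2
  rw [← ofReal_integral_eq_lintegral_ofReal hi (ae_of_all _ fun ω => ?_)]
  · rw [integral_div, integral_add hint.abs hint, h0, add_zero]
  · have := neg_abs_le (Z ω)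
    simp only [Pi.zero_apply]
    linarith

end IteratedSums

namespace IteratedSums

/-! ### The expected lengths of the intervals of tilts -/

lemma p2bar_eq {Ω : Type*} [MeasurableSpace Ω] (P : Measure Ω) (X : ℕ → Ω → ℝ) (n : ℕ) :
    p2bar P X n = P.real {ω | slack (fun i => X i ω) n ≤ 0} :=
  congrArg P.real (Set.ext fun _ => (slack_nonpos_iff _ n).symm)

lemma p2_succ_eq {Ω : Type*} [MeasurableSpace Ω] (P : Measure Ω) (X : ℕ → Ω → ℝ) (n : ℕ) :
    p2 P X (n + 1) = P.real {ω | slack (fun i => X (i + 1) ω) n < -X 0 ω} :=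
  congrArg P.real (Set.ext fun ω => (slack_shift_lt_iff (fun i => X i ω) n).symm)

lemma p2_nonneg {Ω : Type*} [MeasurableSpace Ω] (P : Measure Ω) (X : ℕ → Ω → ℝ) (n : ℕ) :
    0 ≤ p2 P X n := measureReal_nonneg

lemma p2bar_nonneg {Ω : Type*} [MeasurableSpace Ω] (P : Measure Ω) (X : ℕ → Ω → ℝ) (n : ℕ) :
    0 ≤ p2bar P X n := measureReal_nonneg

lemma p2_le_p2bar {Ω : Type*} [MeasurableSpace Ω] (P : Measure Ω) [IsProbabilityMeasure P]
    (X : ℕ → Ω → ℝ) (n : ℕ) : p2 P X n ≤ p2bar P X n :=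
  measureReal_mono fun _ h k h1 h2 => (h k h1 h2).le

lemma p2_antitone {Ω : Type*} [MeasurableSpace Ω] (P : Measure Ω) [IsProbabilityMeasure P]
    (X : ℕ → Ω → ℝ) : Antitone (p2 P X) := fun _ _ h =>
  measureReal_mono fun _ H k h1 h2 => H k h1 (h2.trans h)

lemma p2bar_antitone {Ω : Type*} [MeasurableSpace Ω] (P : Measure Ω) [IsProbabilityMeasure P]
    (X : ℕ → Ω → ℝ) : Antitone (p2bar P X) := fun _ _ h =>
  measureReal_mono fun _ H k h1 h2 => H k h1 (h2.trans h)

/-- The length of the interval of tilts at which the maximum is attained at time `k + 1` by a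
path which has `m` further increments after the `k`-th one. -/
noncomputable def excess (x : ℕ → ℝ) (k m : ℕ) : ℝ :=
  -x k - slack (fun i => x (revIdx k i)) k - slack (fun i => x (k + 1 + i)) m

@[fun_prop] lemma measurable_excess (k m : ℕ) : Measurable fun x : ℕ → ℝ => excess x k m := by
  have h1 : Measurable fun x : ℕ → ℝ => slack (fun i => x (revIdx k i)) k :=
    (measurable_slack k).comp (by fun_prop)
  have h2 : Measurable fun x : ℕ → ℝ => slack (fun i => x (k + 1 + i)) m :=
    (measurable_slack m).comp (by fun_prop)
  unfold excess
  fun_prop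

namespace IsIID

variable {Ω : Type*} [MeasurableSpace Ω] {P : Measure Ω} {X : ℕ → Ω → ℝ}

lemma measurable_slack_path (h : IsIID P X) (k : ℕ) :
    Measurable fun ω => slack (fun i => X i ω) k :=
  (measurable_slack k).comp h.path_measurable

lemma slack_revIdx_ident [IsProbabilityMeasure P] (h : IsIID P X) (k : ℕ) :
    IdentDistrib (fun ω => slack (fun i => X (revIdx k i) ω) k)
      (fun ω => slack (fun i => X i ω) k) P P :=
  (h.path_ident_precomp (revIdx_injective k)).comp (measurable_slack k)

lemma slack_shift_ident [IsProbabilityMeasure P] (h : IsIID P X) (k m : ℕ) :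
    IdentDistrib (fun ω => slack (fun i => X (k + i) ω) m)
      (fun ω => slack (fun i => X i ω) m) P P :=
  (h.path_ident_precomp (add_right_injective k)).comp (measurable_slack m)

lemma slack_revIdx_measurable (h : IsIID P X) (k : ℕ) :
    Measurable fun ω => slack (fun i => X (revIdx k i) ω) k :=
  (measurable_slack k).comp (measurable_pi_lambda _ fun _ => h.measurable _)

lemma slack_shift_measurable (h : IsIID P X) (k m : ℕ) :
    Measurable fun ω => slack (fun i => X (k + i) ω) m :=
  (measurable_slack m).comp (measurable_pi_lambda _ fun _ => h.measurable _)

/-- Keep only the event that both slacks vanish, where `excess` equals `-X k`; past, `k`-th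
increment and future are independent. -/
lemma mul_lintegral_le_lintegral_excess [IsProbabilityMeasure P] (h : IsIID P X) (k m : ℕ) :
    ENNReal.ofReal (p2bar P X k * p2bar P X m) * ∫⁻ ω, ENNReal.ofReal (-X 0 ω) ∂P ≤
      ∫⁻ ω, ENNReal.ofReal (excess (fun i => X i ω) k m) ∂P := by
  set U := fun ω => slack (fun i => X (revIdx k i) ω) k with hU
  set V := fun ω => slack (fun i => X (k + 1 + i) ω) m with hV
  set φ : ℝ → ENNReal := (Set.Iic 0).indicator 1 with hφ
  have hφm : Measurable φ := measurable_one.indicator measurableSet_Iic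
  have hUm : Measurable U := h.slack_revIdx_measurable k
  have hVm : Measurable V := h.slack_shift_measurable (k + 1) m
  have hXk := h.measurable k
  have i1 : IndepFun (fun ω => φ (U ω)) (fun ω => φ (V ω) * ENNReal.ofReal (-X k ω)) P := by
    have : IndepFun U (fun ω => (V ω, X k ω)) P :=
      h.indepFun_of_disjoint (A := Set.Iio k) (B := Set.Ici k)
        (Set.disjoint_left.2 fun i hi hi' => by simp at hi hi'; omega)
        (measurable_slack_revIdx fun i hi => hi)
        (Measurable.prodMk (m := sigmaOf X (Set.Ici k))
          (measurable_slack_shift fun i hi => Set.mem_Ici.2 (by omega))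
          (measurable_sigmaOf (by simp)))
    exact this.comp (φ := φ) (ψ := fun p : ℝ × ℝ => φ p.1 * ENNReal.ofReal (-p.2)) hφm
      (by fun_prop)
  have i2 : IndepFun (fun ω => φ (V ω)) (fun ω => ENNReal.ofReal (-X k ω)) P := by
    have : IndepFun V (X k) P :=
      h.indepFun_of_disjoint (A := Set.Ici (k + 1)) (B := {k}) (by simp)
        (measurable_slack_shift fun i hi => hi) (measurable_sigmaOf rfl)
    exact this.comp (φ := φ) (ψ := fun x : ℝ => ENNReal.ofReal (-x)) hφm (by fun_prop)
  have eφ : ∀ j, ∫⁻ ω, φ (slack (fun i => X i ω) j) ∂P = ENNReal.ofReal (p2bar P X j) := by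
    intro j
    rw [p2bar_eq, ofReal_measureReal]
    exact lintegral_indicator_one (measurableSet_le (h.measurable_slack_path j) measurable_const)
  have eU : ∫⁻ ω, φ (U ω) ∂P = ENNReal.ofReal (p2bar P X k) := by
    rw [← eφ]
    exact ((h.slack_revIdx_ident k).comp hφm).lintegral_eq
  have eV : ∫⁻ ω, φ (V ω) ∂P = ENNReal.ofReal (p2bar P X m) := by
    rw [← eφ]
    exact ((h.slack_shift_ident (k + 1) m).comp hφm).lintegral_eq
  have eX : ∫⁻ ω, ENNReal.ofReal (-X k ω) ∂P = ∫⁻ ω, ENNReal.ofReal (-X 0 ω) ∂P :=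
    ((h.ident k).comp (u := fun x => ENNReal.ofReal (-x)) (by fun_prop)).lintegral_eq
  calc _ = ∫⁻ ω, φ (U ω) * (φ (V ω) * ENNReal.ofReal (-X k ω)) ∂P := by
        rw [lintegral_mul_eq_lintegral_mul_lintegral_of_indepFun'' (by fun_prop) (by fun_prop) i1,
          lintegral_mul_eq_lintegral_mul_lintegral_of_indepFun'' (by fun_prop) (by fun_prop) i2,
          eU, eV, eX, ENNReal.ofReal_mul (p2bar_nonneg P X k), mul_assoc]
    _ ≤ _ := by
        refine lintegral_mono fun ω => ?_
        by_cases h1 : U ω ≤ 0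
        · by_cases h2 : V ω ≤ 0
          · simp only [hφ, Set.indicator_of_mem (Set.mem_Iic.2 h1),
              Set.indicator_of_mem (Set.mem_Iic.2 h2), Pi.one_apply, one_mul]
            refine ENNReal.ofReal_le_ofReal ?_
            have e : excess (fun i => X i ω) k m = -X k ω - U ω - V ω := rfl
            rw [e]
            linarith
          · simp [hφ, h2]
        · simp [hφ, h1]

/-- Integrate out the `k`-th increment with both slacks frozen; the product form of the bound then
lets the independent slacks be averaged separately. -/
lemma lintegral_excess_le [IsProbabilityMeasure P] (h : IsIID P X) (k m : ℕ)
    {g : ℝ → ENNReal} (hg : Measurable g)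
    (hle : ∀ u v : ℝ, 0 ≤ u → 0 ≤ v → ∫⁻ ω, ENNReal.ofReal (-X 0 ω - u - v) ∂P ≤ g u * g v) :
    ∫⁻ ω, ENNReal.ofReal (excess (fun i => X i ω) k m) ∂P ≤
      (∫⁻ ω, g (slack (fun i => X i ω) k) ∂P) * ∫⁻ ω, g (slack (fun i => X i ω) m) ∂P := by
  set U := fun ω => slack (fun i => X (revIdx k i) ω) k with hU
  set V := fun ω => slack (fun i => X (k + 1 + i) ω) m with hV
  have hUm : Measurable U := h.slack_revIdx_measurable k
  have hVm : Measurable V := h.slack_shift_measurable (k + 1) m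
  have hX0 := h.measurable 0
  have hXk := h.measurable k
  have i1 : IndepFun (fun ω => (U ω, V ω)) (X k) P :=
    h.indepFun_of_disjoint (A := {k}ᶜ) (B := {k}) disjoint_compl_left
      (Measurable.prodMk (m := sigmaOf X {k}ᶜ)
        (measurable_slack_revIdx fun i hi => Set.mem_compl_singleton_iff.2 (by omega))
        (measurable_slack_shift fun i hi => Set.mem_compl_singleton_iff.2 (by omega)))
      (measurable_sigmaOf rfl)
  have i2 : IndepFun U V P :=
    h.indepFun_of_disjoint (A := Set.Iio k) (B := Set.Ici (k + 1))
      (Set.disjoint_left.2 fun i hi hi' => by simp at hi hi'; omega)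
      (measurable_slack_revIdx fun i hi => hi) (measurable_slack_shift fun i hi => hi)
  calc ∫⁻ ω, ENNReal.ofReal (excess (fun i => X i ω) k m) ∂P
      = ∫⁻ ω, (fun p : (ℝ × ℝ) × ℝ => ENNReal.ofReal (-p.2 - p.1.1 - p.1.2))
          ((U ω, V ω), X k ω) ∂P := rfl
    _ = ∫⁻ ω, ∫⁻ ω', ENNReal.ofReal (-X 0 ω' - U ω - V ω) ∂P ∂P := by
        rw [← lintegral_map (f := fun p : (ℝ × ℝ) × ℝ => ENNReal.ofReal (-p.2 - p.1.1 - p.1.2))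
            (g := fun ω => ((U ω, V ω), X k ω)) (by fun_prop) (by fun_prop),
          i1.map_prod_eq_prod_map_map (by fun_prop) (by fun_prop), (h.ident k).map_eq,
          lintegral_prod _ (by fun_prop),
          lintegral_map (f := fun p : ℝ × ℝ => ∫⁻ y, ENNReal.ofReal (-y - p.1 - p.2) ∂(P.map (X 0)))
            (Measurable.lintegral_prod_right' (f := fun p : (ℝ × ℝ) × ℝ =>
              ENNReal.ofReal (-p.2 - p.1.1 - p.1.2)) (by fun_prop)) (by fun_prop)]
        refine lintegral_congr fun ω => ?_
        rw [lintegral_map (by fun_prop) (by fun_prop)]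
    _ ≤ ∫⁻ ω, g (U ω) * g (V ω) ∂P :=
        lintegral_mono fun ω => hle _ _ (slack_nonneg _ _) (slack_nonneg _ _)
    _ = _ := by
        rw [lintegral_mul_eq_lintegral_mul_lintegral_of_indepFun'' (f := fun ω => g (U ω))
          (g := fun ω => g (V ω)) (by fun_prop) (by fun_prop) (i2.comp hg hg)]
        exact congrArg₂ _ ((h.slack_revIdx_ident k).comp hg).lintegral_eq
          ((h.slack_shift_ident (k + 1) m).comp hg).lintegral_eq

lemma sum_lintegral_excess [IsProbabilityMeasure P] (h : IsIID P X) (n : ℕ) :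
    ∑ k ∈ Finset.range (n + 1), ∫⁻ ω, ENNReal.ofReal (excess (fun i => X i ω) k (n - k)) ∂P =
      ∫⁻ ω, ∑ k ∈ Finset.range (n + 1), volume (argmaxSet (fun i => X i ω) n k) ∂P := by
  have hp := h.path_measurable
  rw [← lintegral_finsetSum]
  · refine lintegral_congr fun ω => Finset.sum_congr rfl fun k hk => ?_
    have := Finset.mem_range.1 hk
    rw [volume_argmaxSet _ (by omega)]
    rfl
  · intro k _
    exact ((measurable_excess k (n - k)).comp hp).ennreal_ofReal

/-! ### The upper bound on the convolution -/

lemma lintegral_runMax_le_add [IsProbabilityMeasure P] (h : IsIID P X)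
    (hint : Integrable (X 0) P) (h0 : ∫ ω, X 0 ω ∂P = 0) {u : ℝ} (hu : 0 ≤ u) {N : ℕ}
    (hN : ∀ m ≤ N, 1 ≤ 2 * P {ω | -u ≤ psum (fun i => X i ω) m}) :
    ∫⁻ ω, ENNReal.ofReal (runMax N (fun i => X i ω)) ∂P ≤
      ENNReal.ofReal (u + ∫ ω, |psum (fun i => X i ω) N| ∂P) := by
  have h1 := h.lintegral_runMax_le hu hN 0
  simp only [sub_zero] at h1
  rw [lintegral_ofReal_of_integral_eq_zero (h.integrable_psum hint N)
    (h.integral_psum hint h0 N)] at h1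
  calc ∫⁻ ω, ENNReal.ofReal (runMax N (fun i => X i ω)) ∂P
      ≤ ∫⁻ ω, (ENNReal.ofReal (runMax N (fun i => X i ω) - u) + ENNReal.ofReal u) ∂P := by
        refine lintegral_mono fun ω => ?_
        rw [← sub_add_cancel (runMax N (fun i => X i ω)) u]
        simpa using ENNReal.ofReal_add_le (p := runMax N (fun i => X i ω) - u) (q := u)
    _ = ∫⁻ ω, ENNReal.ofReal (runMax N (fun i => X i ω) - u) ∂P + ENNReal.ofReal u := by
        rw [lintegral_add_right _ measurable_const]
        simp
    _ ≤ 2 * ENNReal.ofReal ((∫ ω, |psum (fun i => X i ω) N| ∂P) / 2) + ENNReal.ofReal u := by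
        gcongr
    _ = _ := by
        have hA : 0 ≤ ∫ ω, |psum (fun i => X i ω) N| ∂P := integral_nonneg fun _ => abs_nonneg _
        rw [← ENNReal.ofReal_ofNat 2, ← ENNReal.ofReal_mul (by norm_num),
          ← ENNReal.ofReal_add (by positivity) hu]
        congr 1
        ring

/-- The upper bound on the convolution, given one-sided lower bounds on the partial sums
which hold with probability at least one half. -/
lemma sum_p2bar_mul_le [IsProbabilityMeasure P] (h : IsIID P X)
    (hint : Integrable (X 0) P) (h0 : ∫ ω, X 0 ω ∂P = 0) {u : ℝ} (hu : 0 ≤ u) {n : ℕ}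
    (hN : ∀ m ≤ n + 1, 1 ≤ 2 * P {ω | -u ≤ psum (fun i => X i ω) m})
    (hN' : ∀ m ≤ n + 1, 1 ≤ 2 * P {ω | -u ≤ -psum (fun i => X i ω) m}) :
    (∑ k ∈ Finset.range (n + 1), p2bar P X k * p2bar P X (n - k)) * (∫ ω, |X 0 ω| ∂P) ≤
      4 * (u + ∫ ω, |psum (fun i => X i ω) (n + 1)| ∂P) := by
  set A := ∫ ω, |psum (fun i => X i ω) (n + 1)| ∂P with hA
  have hA0 : 0 ≤ A := integral_nonneg fun _ => abs_nonneg _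
  have hE0 : 0 ≤ ∫ ω, |X 0 ω| ∂P := integral_nonneg fun _ => abs_nonneg _
  have eY : ∫⁻ ω, ENNReal.ofReal (-X 0 ω) ∂P = ENNReal.ofReal ((∫ ω, |X 0 ω| ∂P) / 2) := by
    rw [lintegral_ofReal_of_integral_eq_zero hint.fun_neg (by rw [integral_neg, h0, neg_zero])]
    simp
  have hM := h.lintegral_runMax_le_add hint h0 hu hN
  have hM' := h.neg.lintegral_runMax_le_add (hint.fun_neg : Integrable (fun ω => -X 0 ω) P)
    (by rw [integral_neg, h0, neg_zero]) hu (N := n + 1)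
    (fun m hm => by simpa only [psum_neg] using hN' m hm)
  simp only [psum_neg, abs_neg] at hM'
  have hrm : Measurable fun ω => runMax (n + 1) (fun i => X i ω) :=
    (measurable_runMax (n + 1)).comp h.path_measurable
  have key : ENNReal.ofReal ((∑ k ∈ Finset.range (n + 1), p2bar P X k * p2bar P X (n - k)) *
      ((∫ ω, |X 0 ω| ∂P) / 2)) ≤ ENNReal.ofReal (2 * (u + A)) := by
    calc _ = ∑ k ∈ Finset.range (n + 1), ENNReal.ofReal (p2bar P X k * p2bar P X (n - k)) *
            ∫⁻ ω, ENNReal.ofReal (-X 0 ω) ∂P := by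
          rw [ENNReal.ofReal_mul' (by positivity), ENNReal.ofReal_sum_of_nonneg
            (fun _ _ => mul_nonneg (p2bar_nonneg _ _ _) (p2bar_nonneg _ _ _)), eY, Finset.sum_mul]
      _ ≤ ∑ k ∈ Finset.range (n + 1),
            ∫⁻ ω, ENNReal.ofReal (excess (fun i => X i ω) k (n - k)) ∂P :=
          Finset.sum_le_sum fun k _ => h.mul_lintegral_le_lintegral_excess k (n - k)
      _ ≤ ∫⁻ ω, (ENNReal.ofReal (runMax (n + 1) (fun i => X i ω)) +
            ENNReal.ofReal (runMax (n + 1) (fun i => -X i ω))) ∂P := by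
          rw [h.sum_lintegral_excess]
          refine lintegral_mono fun ω => (sum_volume_argmaxSet_le _ n).trans ?_
          exact ENNReal.ofReal_add_le
      _ ≤ ENNReal.ofReal (u + A) + ENNReal.ofReal (u + A) := by
          rw [lintegral_add_left hrm.ennreal_ofReal]
          gcongr
      _ = _ := by
          rw [← ENNReal.ofReal_add (by positivity) (by positivity)]
          congr 1
          ring
  have := (ENNReal.ofReal_le_ofReal_iff (by positivity)).1 key
  linarith

lemma half_le_measure_neg_le [IsProbabilityMeasure P] {Z : Ω → ℝ} (hZ : Integrable Z P)
    {u : ℝ} (hu : 0 < u) (h : 2 * ∫ ω, |Z ω| ∂P ≤ u) : 1 ≤ 2 * P {ω | -u ≤ Z ω} := by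
  have h1 := mul_meas_ge_le_integral_of_nonneg (ae_of_all P fun ω => abs_nonneg (Z ω)) hZ.abs u
  have h2 : 1 ≤ P.real {ω | -u ≤ Z ω} + P.real {ω | u ≤ |Z ω|} := by
    refine le_trans ?_ (measureReal_union_le _ _)
    rw [← probReal_univ (μ := P)]
    refine measureReal_mono fun ω _ => ?_
    rcases le_or_gt (-u) (Z ω) with h | h
    · exact Or.inl h
    · exact Or.inr (by
        have := neg_abs_le (Z ω)
        simp only [Set.mem_ofPred_eq]
        have := neg_le_abs (Z ω)
        linarith)
  have h3 : P.real {ω | u ≤ |Z ω|} ≤ 1 / 2 := by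
    by_contra! hc
    nlinarith
  have h4 : 1 ≤ 2 * P.real {ω | -u ≤ Z ω} := by linarith
  have h5 := ENNReal.ofReal_le_ofReal h4
  rwa [ENNReal.ofReal_mul (by norm_num), ofReal_measureReal, ENNReal.ofReal_one,
    ENNReal.ofReal_ofNat] at h5

/-- By symmetry each partial sum is nonnegative with probability at least one half, so `u = 0` is
allowed. -/
lemma sum_p2bar_mul_le_of_symmetric [IsProbabilityMeasure P] (h : IsIID P X)
    (hint : Integrable (X 0) P) (h0 : ∫ ω, X 0 ω ∂P = 0) (hs : SymmetricLaw P (X 0)) (n : ℕ) :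
    (∑ k ∈ Finset.range (n + 1), p2bar P X k * p2bar P X (n - k)) * (∫ ω, |X 0 ω| ∂P) ≤
      4 * ∫ ω, |psum (fun i => X i ω) (n + 1)| ∂P := by
  have hid : ∀ m, P {ω | 0 ≤ psum (fun i => X i ω) m} =
      P {ω | 0 ≤ -psum (fun i => X i ω) m} := by
    intro m
    have := ((h.path_ident h.neg hs).comp (measurable_psum m)).measure_mem_eq measurableSet_Ici
      (s := Set.Ici 0)
    simp only [← psum_neg]
    exact this
  have hle : ∀ m, 1 ≤ 2 * P {ω | 0 ≤ psum (fun i => X i ω) m} := by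
    intro m
    rw [two_mul]
    conv_rhs => rw [hid m]
    conv_rhs => lhs; rw [← hid m]
    refine le_trans ?_ (measure_union_le _ _)
    rw [← measure_univ (μ := P)]
    refine measure_mono fun ω _ => ?_
    rcases le_total 0 (psum (fun i => X i ω) m) with h | h
    · exact Or.inl h
    · exact Or.inr (neg_nonneg.2 h)
  have := h.sum_p2bar_mul_le hint h0 le_rfl (n := n) (fun m _ => by simpa only [neg_zero] using hle m)
    (fun m _ => by simpa only [neg_zero, hid m] using hle m)
  simpa using this

lemma integral_abs_le_integral_abs_psum [IsProbabilityMeasure P] (h : IsIID P X)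
    (hint : Integrable (X 0) P) (h0 : ∫ ω, X 0 ω ∂P = 0) (n : ℕ) :
    ∫ ω, |X 0 ω| ∂P ≤ ∫ ω, |psum (fun i => X i ω) (n + 1)| ∂P := by
  have := h.monotone_integral_abs_psum hint h0 (show 1 ≤ n + 1 by omega)
  simpa [psum] using this

/-- By Markov's inequality and monotonicity, `u = 2 E|S_{n+1}|` serves for every `m ≤ n + 1`; the
constant is `4 * (2 + 1)`. -/
lemma sum_p2bar_mul_le_general [IsProbabilityMeasure P] (h : IsIID P X)
    (hint : Integrable (X 0) P) (h0 : ∫ ω, X 0 ω ∂P = 0) (hpos : 0 < ∫ ω, |X 0 ω| ∂P) (n : ℕ) :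
    (∑ k ∈ Finset.range (n + 1), p2bar P X k * p2bar P X (n - k)) * (∫ ω, |X 0 ω| ∂P) ≤
      12 * ∫ ω, |psum (fun i => X i ω) (n + 1)| ∂P := by
  have hA := hpos.trans_le (h.integral_abs_le_integral_abs_psum hint h0 n)
  have hmono := h.monotone_integral_abs_psum hint h0
  have := h.sum_p2bar_mul_le hint h0 (n := n)
    (u := 2 * ∫ ω, |psum (fun i => X i ω) (n + 1)| ∂P) (by positivity)
    (fun m hm => half_le_measure_neg_le (h.integrable_psum hint m) (by positivity)
      (mul_le_mul_of_nonneg_left (hmono hm) zero_le_two))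
    (fun m hm => half_le_measure_neg_le (h.integrable_psum hint m).fun_neg (by positivity) (by
      simp only [abs_neg]
      exact mul_le_mul_of_nonneg_left (hmono hm) zero_le_two))
  linarith

end IsIID

end IteratedSums

namespace IteratedSums

/-! ### The lower bound -/

/-- The exponential part of the decay function. -/
noncomputable def expPart (q θ t : ℝ) : ℝ := if q = 0 then 0 else q ^ (θ * t)

/-- The lower tail of `Y` plus an exponential; it is submultiplicative up to a constant under
the decay assumption. -/
noncomputable def decayFun {Ω : Type*} [MeasurableSpace Ω] (P : Measure Ω) (Y : Ω → ℝ)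
    (θ r t : ℝ) : ℝ :=
  lowerTail P Y t + expPart (lowerTail P Y r) θ t

lemma expPart_nonneg {q : ℝ} (hq : 0 ≤ q) (θ t : ℝ) : 0 ≤ expPart q θ t := by
  unfold expPart
  split_ifs
  exacts [le_rfl, Real.rpow_nonneg hq _]

lemma expPart_add {q : ℝ} (hq : 0 ≤ q) (θ t s : ℝ) :
    expPart q θ (t + s) = expPart q θ t * expPart q θ s := by
  unfold expPart
  split_ifs with h
  · simp
  · rw [mul_add, Real.rpow_add (lt_of_le_of_ne hq (Ne.symm h))]

lemma expPart_antitone {q θ : ℝ} (hq : 0 ≤ q) (hq1 : q ≤ 1) (hθ : 0 ≤ θ) :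
    Antitone (expPart q θ) := by
  intro s t hst
  unfold expPart
  split_ifs with h
  · exact le_rfl
  · exact Real.rpow_le_rpow_of_exponent_ge (lt_of_le_of_ne hq (Ne.symm h)) hq1
      (mul_le_mul_of_nonneg_left hst hθ)

lemma expPart_le_one {q θ t : ℝ} (hq : 0 ≤ q) (hq1 : q ≤ 1) (hθ : 0 ≤ θ) (ht : 0 ≤ t) :
    expPart q θ t ≤ 1 := by
  refine (expPart_antitone hq hq1 hθ ht).trans ?_
  unfold expPart
  split_ifs <;> simp

lemma continuous_expPart (q θ : ℝ) : Continuous (expPart q θ) := by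
  unfold expPart
  split_ifs with h
  · exact continuous_const
  · exact continuous_const.rpow (by fun_prop) fun _ => Or.inl h

lemma lowerTail_nonneg {Ω : Type*} [MeasurableSpace Ω] {P : Measure Ω} {Y : Ω → ℝ} (t : ℝ) :
    0 ≤ lowerTail P Y t := measureReal_nonneg

lemma decayFun_nonneg {Ω : Type*} [MeasurableSpace Ω] {P : Measure Ω} {Y : Ω → ℝ} (θ r t : ℝ) :
    0 ≤ decayFun P Y θ r t :=
  add_nonneg (lowerTail_nonneg _) (expPart_nonneg (lowerTail_nonneg _) _ _)

/-! ### Submultiplicativity and integral of the decay function -/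

section Tail

variable {Ω : Type*} [MeasurableSpace Ω] {P : Measure Ω} [IsProbabilityMeasure P] {Y : Ω → ℝ}

lemma lowerTail_le_one (t : ℝ) : lowerTail P Y t ≤ 1 := measureReal_le_one

lemma ofReal_lowerTail (t : ℝ) : ENNReal.ofReal (lowerTail P Y t) = P {ω | t < -Y ω} :=
  ofReal_measureReal

lemma lowerTail_antitone : Antitone (lowerTail P Y) := fun _ _ h =>
  measureReal_mono fun _ hω => lt_of_le_of_lt h hω

lemma tendsto_lowerTail (t : ℝ) :
    Filter.Tendsto (fun n : ℕ => lowerTail P Y (t + 1 / ((n : ℝ) + 1))) Filter.atTop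
      (nhds (lowerTail P Y t)) := by
  have hanti : Antitone fun n : ℕ => 1 / ((n : ℝ) + 1) := fun a b hab =>
    one_div_le_one_div_of_le (by positivity) (by simpa using hab)
  have hU : (⋃ n : ℕ, {ω | t + 1 / ((n : ℝ) + 1) < -Y ω}) = {ω | t < -Y ω} := by
    ext ω
    simp only [Set.mem_iUnion, Set.mem_ofPred_eq]
    constructor
    · rintro ⟨n, hn⟩
      have : 0 < 1 / ((n : ℝ) + 1) := by positivity
      linarith
    · intro h
      obtain ⟨n, hn⟩ := exists_nat_one_div_lt (sub_pos.2 h)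
      exact ⟨n, by linarith⟩
  have := tendsto_measure_iUnion_atTop (μ := P)
    (s := fun n : ℕ => {ω | t + 1 / ((n : ℝ) + 1) < -Y ω})
    (fun a b hab ω hω => lt_of_le_of_lt (add_le_add_right (hanti hab) t) hω)
  rw [hU] at this
  exact (ENNReal.tendsto_toReal (measure_ne_top _ _)).comp this

lemma measurable_decayFun (θ r : ℝ) : Measurable (decayFun P Y θ r) :=
  lowerTail_antitone.measurable.add (continuous_expPart _ _).measurable

lemma decayFun_add_le {K L θ r : ℝ} (hD : DecayAssumption P Y K L θ r)
    {t s : ℝ} (ht : 0 ≤ t) (hs : 0 ≤ s) :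
    decayFun P Y θ r (t + s) ≤
      (|K| + |L| + 1) * (decayFun P Y θ r t * decayFun P Y θ r s) := by
  obtain ⟨hr, hθ, hD⟩ := hD
  have hθ0 : 0 < θ := (one_div_pos.2 hr).trans hθ
  set q := lowerTail P Y r with hq
  have hq0 : 0 ≤ q := lowerTail_nonneg _
  have hpos : ∀ t s : ℝ, 0 < t → 0 < s → decayFun P Y θ r (t + s) ≤
      (|K| + |L| + 1) * (decayFun P Y θ r t * decayFun P Y θ r s) := by
    intro t s ht hs
    have h1 := hD t s ht hs
    -- At `q = 0` this uses `t + s > 0`: `expPart` is then identically zero, whereas `0 ^ 0 = 1`.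
    have e : q ^ (θ * (t + s)) = expPart q θ (t + s) := by
      unfold expPart
      split_ifs with h
      · rw [h, Real.zero_rpow (by positivity)]
      · rfl
    rw [e, expPart_add hq0] at h1
    unfold decayFun
    rw [← hq, expPart_add hq0]
    have a0 : 0 ≤ lowerTail P Y t := lowerTail_nonneg _
    have b0 : 0 ≤ lowerTail P Y s := lowerTail_nonneg _
    generalize lowerTail P Y t = a at *
    generalize lowerTail P Y s = b at *
    have c0 := expPart_nonneg hq0 θ t
    have d0 := expPart_nonneg hq0 θ s
    generalize expPart q θ t = c at *
    generalize expPart q θ s = d at *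
    have hK : K * a * b ≤ |K| * (a * b) := by
      rw [mul_assoc]
      exact mul_le_mul_of_nonneg_right (le_abs_self K) (by positivity)
    have hL : L * (c * d) ≤ |L| * (c * d) :=
      mul_le_mul_of_nonneg_right (le_abs_self L) (by positivity)
    have : |K| * (a * b) + |L| * (c * d) + c * d ≤
        (|K| + |L| + 1) * ((a + c) * (b + d)) := by
      have e : (|K| + |L| + 1) * ((a + c) * (b + d)) - (|K| * (a * b) + |L| * (c * d) + c * d) =
        |K| * (a * d + c * b + c * d) + |L| * (a * b + a * d + c * b) +
          (a * b + a * d + c * b) := by ring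
      have : 0 ≤ |K| * (a * d + c * b + c * d) + |L| * (a * b + a * d + c * b) +
          (a * b + a * d + c * b) := by positivity
      linarith
    linarith
  -- The assumption covers positive arguments only, but slacks can be zero; right continuity extends
  -- the inequality, one argument at a time.
  have hlim : ∀ t, Filter.Tendsto (fun n : ℕ => decayFun P Y θ r (t + 1 / ((n : ℝ) + 1)))
      Filter.atTop (nhds (decayFun P Y θ r t)) := by
    intro t
    refine (tendsto_lowerTail t).add (((continuous_expPart q θ).tendsto t).comp ?_)
    simpa using tendsto_const_nhds.add tendsto_one_div_add_atTop_nhds_zero_nat (a := t)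
  have hnonneg : ∀ t s : ℝ, 0 ≤ t → 0 < s → decayFun P Y θ r (t + s) ≤
      (|K| + |L| + 1) * (decayFun P Y θ r t * decayFun P Y θ r s) := fun t s ht hs =>
    le_of_tendsto_of_tendsto' (hlim (t + s)) (((hlim t).mul_const _).const_mul _) fun n => by
      rw [add_right_comm]
      exact hpos _ _ (by positivity) hs
  exact le_of_tendsto_of_tendsto' (hlim (t + s)) (((hlim s).const_mul _).const_mul _) fun n => by
    rw [add_assoc]
    exact hnonneg _ _ ht (by positivity)

lemma lintegral_ofReal_neg_sub (hY : Measurable Y) (c : ℝ) :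
    ∫⁻ ω, ENNReal.ofReal (-Y ω - c) ∂P =
      ∫⁻ t in Set.Ioi 0, ENNReal.ofReal (lowerTail P Y (c + t)) := by
  have e : ∀ ω, ENNReal.ofReal (-Y ω - c) = ENNReal.ofReal (max (-Y ω - c) 0) := fun ω => by
    rw [ENNReal.ofReal_max, ENNReal.ofReal_zero, max_eq_left zero_le]
  simp only [e]
  rw [lintegral_eq_lintegral_meas_lt (f := fun ω => max (-Y ω - c) 0) P
    (ae_of_all _ fun ω => le_max_right _ _) (by fun_prop)]
  refine setLIntegral_congr_fun measurableSet_Ioi fun t ht => ?_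
  simp only [ofReal_lowerTail]
  refine congrArg P (Set.ext fun ω => ?_)
  have ht : 0 < t := ht
  simp only [Set.mem_ofPred_eq, lt_max_iff]
  constructor
  · rintro (h | h) <;> linarith
  · intro h
    exact Or.inl (by linarith)

/-- The integral is `1 / (θ * -log q)` when `q > 0`. The factor `r * q` is split off because
Markov's inequality bounds it by the mean of the negative part. -/
lemma lintegral_expPart_le {q θ r : ℝ} (hq : 0 ≤ q) (hq1 : q < 1) (hr : 0 < r) (hθ : 0 < θ) :
    ∫⁻ t in Set.Ioi 0, ENNReal.ofReal (expPart q θ t) ≤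
      ENNReal.ofReal (1 / (θ * -Real.log q * r * q)) * ENNReal.ofReal (r * q) := by
  rcases eq_or_lt_of_le hq with h | h
  · simp [expPart, ← h]
  · have hlog : Real.log q < 0 := Real.log_neg h hq1
    have ha : Real.log q * θ < 0 := mul_neg_of_neg_of_pos hlog hθ
    have e : ∀ t, expPart q θ t = Real.exp (Real.log q * θ * t) := fun t => by
      rw [expPart, if_neg h.ne', Real.rpow_def_of_pos h, mul_assoc]
    simp only [e]
    rw [← ofReal_integral_eq_lintegral_ofReal (integrableOn_exp_mul_Ioi ha 0)
      (ae_of_all _ fun _ => (Real.exp_pos _).le), integral_exp_mul_Ioi ha,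
      ← ENNReal.ofReal_mul' (by positivity)]
    refine ENNReal.ofReal_le_ofReal (le_of_eq ?_)
    have := hlog.ne
    simp only [mul_zero, Real.exp_zero]
    field_simp

lemma lintegral_decayFun_le (hY : Measurable Y) {θ r : ℝ} (hr : 0 < r) (hθ : 0 < θ)
    (hq1 : lowerTail P Y r < 1) :
    ∫⁻ t in Set.Ioi 0, ENNReal.ofReal (decayFun P Y θ r t) ≤
      ENNReal.ofReal (1 + |1 / (θ * -Real.log (lowerTail P Y r) * r * lowerTail P Y r)|) *
        ∫⁻ ω, ENNReal.ofReal (-Y ω) ∂P := by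
  set q := lowerTail P Y r with hq
  have hq0 : 0 ≤ q := lowerTail_nonneg _
  have hM : ENNReal.ofReal (r * q) ≤ ∫⁻ ω, ENNReal.ofReal (-Y ω) ∂P := by
    rw [ENNReal.ofReal_mul hr.le, hq, ofReal_lowerTail]
    refine le_trans ?_ (mul_meas_ge_le_lintegral (by fun_prop) (ENNReal.ofReal r))
    gcongr with ω
    intro hω
    exact ENNReal.ofReal_le_ofReal (le_of_lt hω)
  have h0 := lintegral_ofReal_neg_sub (P := P) hY 0
  simp only [sub_zero, zero_add] at h0
  calc _ = ∫⁻ t in Set.Ioi 0, (ENNReal.ofReal (lowerTail P Y t) +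
        ENNReal.ofReal (expPart q θ t)) := by
        refine lintegral_congr fun t => ?_
        rw [decayFun, ENNReal.ofReal_add (lowerTail_nonneg _) (expPart_nonneg hq0 _ _)]
    _ = ∫⁻ ω, ENNReal.ofReal (-Y ω) ∂P + ∫⁻ t in Set.Ioi 0, ENNReal.ofReal (expPart q θ t) := by
        rw [lintegral_add_left lowerTail_antitone.measurable.ennreal_ofReal, h0]
    _ ≤ ∫⁻ ω, ENNReal.ofReal (-Y ω) ∂P + ENNReal.ofReal |1 / (θ * -Real.log q * r * q)| *
          ∫⁻ ω, ENNReal.ofReal (-Y ω) ∂P := by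
        gcongr
        refine (lintegral_expPart_le hq0 hq1 hr hθ).trans ?_
        gcongr
        exact le_abs_self _
    _ = _ := by
        rw [ENNReal.ofReal_add zero_le_one (abs_nonneg _), ENNReal.ofReal_one, add_mul, one_mul]

lemma lowerTail_lt_one (hY : Integrable Y P) (hm : Measurable Y) (h0 : ∫ ω, Y ω ∂P = 0) {r : ℝ}
    (hr : 0 < r) : lowerTail P Y r < 1 := by
  refine lt_of_le_of_ne (lowerTail_le_one r) fun h => ?_
  have hae : ∀ᵐ ω ∂P, r < -Y ω := by
    have hms : MeasurableSet {ω | r < -Y ω} := measurableSet_lt measurable_const hm.neg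
    have h2 : P {ω | r < -Y ω} = 1 := by
      rw [← ofReal_lowerTail, h, ENNReal.ofReal_one]
    exact (prob_compl_eq_zero_iff hms).2 h2
  have := integral_mono_ae (integrable_const r) hY.fun_neg (hae.mono fun ω h => h.le)
  rw [integral_neg, h0] at this
  simp at this
  linarith

end Tail

/-! ### Averages of the decay function at the slack, and the lower bound on the convolution -/

namespace IsIID

variable {Ω : Type*} [MeasurableSpace Ω] {P : Measure Ω} [IsProbabilityMeasure P]
  {X : ℕ → Ω → ℝ}

lemma lintegral_lowerTail_slack (h : IsIID P X) (k : ℕ) :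
    ∫⁻ ω, ENNReal.ofReal (lowerTail P (X 0) (slack (fun i => X i ω) k)) ∂P =
      ENNReal.ofReal (p2 P X (k + 1)) := by
  have hs := h.measurable_slack_path k
  have hs' : Measurable fun ω => slack (fun i => X (i + 1) ω) k := by
    simpa only [add_comm 1] using h.slack_shift_measurable 1 k
  have h0 := h.measurable 0
  have hind : IndepFun (fun ω => slack (fun i => X (i + 1) ω) k) (X 0) P := by
    simp only [add_comm _ 1]
    exact h.indepFun_of_disjoint (A := Set.Ici 1) (B := {0}) (by simp)
      (measurable_slack_shift fun i hi => hi) (measurable_sigmaOf rfl)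
  have hid := h.slack_shift_ident 1 k
  simp only [add_comm 1] at hid
  have hM : MeasurableSet {p : ℝ × ℝ | p.1 < -p.2} :=
    measurableSet_lt measurable_fst measurable_snd.neg
  rw [p2_succ_eq, ofReal_measureReal]
  have e : P {ω | slack (fun i => X (i + 1) ω) k < -X 0 ω} =
      P.map (fun ω => (slack (fun i => X (i + 1) ω) k, X 0 ω)) {p : ℝ × ℝ | p.1 < -p.2} := by
    rw [Measure.map_apply (by fun_prop) hM]
    rfl
  rw [e, hind.map_prod_eq_prod_map_map hs'.aemeasurable h0.aemeasurable, hid.map_eq,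
    Measure.prod_apply hM, lintegral_map (measurable_measure_prodMk_left hM) hs]
  refine lintegral_congr fun ω => ?_
  rw [ofReal_lowerTail, Measure.map_apply h0 (measurable_prodMk_left hM)]
  rfl

lemma mul_lintegral_le_of_first_step (h : IsIID P X) {g : (ℕ → ℝ) → ENNReal} (hg : Measurable g)
    (r : ℝ) : ENNReal.ofReal (lowerTail P (X 0) r) * ∫⁻ ω, g (fun i => X i ω) ∂P =
      ∫⁻ ω, {ω | r < -X 0 ω}.indicator (fun ω => g (fun i => X (i + 1) ω)) ω ∂P := by
  have hM : MeasurableSet {y : ℝ | r < -y} := measurableSet_lt measurable_const measurable_neg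
  have hM' : MeasurableSet {ω | r < -X 0 ω} := measurableSet_lt measurable_const
    (h.measurable 0).neg
  have e : ∀ ω, {ω | r < -X 0 ω}.indicator (fun ω => g (fun i => X (i + 1) ω)) ω =
      {y : ℝ | r < -y}.indicator (fun _ => (1 : ENNReal)) (X 0 ω) *
        g (fun i => X (i + 1) ω) := by
    intro ω
    by_cases hω : r < -X 0 ω <;> simp [Set.indicator, hω]
  simp only [e]
  rw [h.lintegral_first_step
    (f := fun p => {y : ℝ | r < -y}.indicator (fun _ => (1 : ENNReal)) p.1 * g p.2)
    (((measurable_const.indicator hM).comp measurable_fst).mul (hg.comp measurable_snd))]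
  have e2 : ∀ ω, ∫⁻ ω', {y : ℝ | r < -y}.indicator (fun _ => (1 : ENNReal)) (X 0 ω) *
      g (fun i => X i ω') ∂P = {ω | r < -X 0 ω}.indicator 1 ω * ∫⁻ ω', g (fun i => X i ω') ∂P :=
    fun ω => lintegral_const_mul _ (hg.comp h.path_measurable)
  simp only [e2]
  rw [lintegral_mul_const _ (measurable_one.indicator hM'), lintegral_indicator_one hM',
    ofReal_lowerTail]

/-- With `e` the average on the left and `β = q ^ (θ * r)`, prefixing a step below `-r` yields `q *
e ≤ p2 k + β * e`. Since `θ * r > 1` and `0 < q < 1`, `β < q` and this can be solved for `e`. -/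
lemma lintegral_expPart_slack_le (h : IsIID P X) {θ r : ℝ} (hr : 0 < r) (hθ : 1 / r < θ)
    (hq1 : lowerTail P (X 0) r < 1) (k : ℕ) :
    ∫⁻ ω, ENNReal.ofReal (expPart (lowerTail P (X 0) r) θ (slack (fun i => X i ω) k)) ∂P ≤
      ENNReal.ofReal (|1 / (lowerTail P (X 0) r - lowerTail P (X 0) r ^ (θ * r))| * p2 P X k) := by
  have hθ0 : 0 < θ := (one_div_pos.2 hr).trans hθ
  have hs := h.measurable_slack_path k
  set q := lowerTail P (X 0) r with hq
  rcases eq_or_lt_of_le (lowerTail_nonneg r : 0 ≤ q) with hq0 | hq0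
  · simp [expPart, show q = 0 from hq0.symm]
  set β := q ^ (θ * r) with hβ
  have hβ0 : 0 < β := Real.rpow_pos_of_pos hq0 _
  have hβq : β < q := by
    have := Real.rpow_lt_rpow_of_exponent_gt hq0 hq1 ((div_lt_iff₀ hr).1 hθ)
    rwa [Real.rpow_one] at this
  set w := expPart q θ with hw
  have hwm : Measurable w := (continuous_expPart q θ).measurable
  have hw0 : ∀ t, 0 ≤ w t := expPart_nonneg hq0.le θ
  have hwr : w r = β := if_neg hq0.ne'
  have hanti : Antitone w := expPart_antitone hq0.le hq1.le hθ0.le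
  set e := ∫⁻ ω, ENNReal.ofReal (w (slack (fun i => X i ω) k)) ∂P with he
  set I := ∫⁻ ω, ENNReal.ofReal (w (max (slack (fun i => X i ω) k - r) 0)) ∂P with hI
  have he1 : e ≤ 1 := by
    refine (lintegral_mono (g := fun _ => 1) fun ω => ?_).trans (by simp)
    exact ENNReal.ofReal_le_one.2 (expPart_le_one hq0.le hq1.le hθ0.le (slack_nonneg _ _))
  have hSm : MeasurableSet {ω | slack (fun i => X i ω) k ≤ r} :=
    measurableSet_le hs measurable_const
  -- Bound the exponential by one where the slack is at most `r`; elsewhere pull out the factor `w r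
  -- = β`.
  have h1 : e ≤ P {ω | slack (fun i => X i ω) k ≤ r} + ENNReal.ofReal β * I := by
    rw [hI, ← lintegral_const_mul' _ _ (by simp), ← lintegral_indicator_one hSm,
      ← lintegral_add_left (measurable_one.indicator hSm)]
    refine lintegral_mono fun ω => ?_
    by_cases hω : slack (fun i => X i ω) k ≤ r
    · rw [Set.indicator_of_mem (by exact hω)]
      refine le_add_right (ENNReal.ofReal_le_one.2 ?_)
      exact expPart_le_one hq0.le hq1.le hθ0.le (slack_nonneg _ _)
    · rw [← ENNReal.ofReal_mul hβ0.le, ← hwr, hw, ← expPart_add hq0.le,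
        max_eq_left (by linarith), add_sub_cancel]
      exact le_add_self
  -- A first step below `-r` lowers the slack of the rest by `r`, and the slack grows with the
  -- length of the path.
  have h2 : ENNReal.ofReal q * I ≤ e := by
    have := h.mul_lintegral_le_of_first_step
      (g := fun x => ENNReal.ofReal (w (max (slack x k - r) 0))) (by fun_prop) r
    rw [hI, hq, this, he]
    refine le_trans (lintegral_mono (g := fun ω =>
      ENNReal.ofReal (w (slack (fun i => X i ω) (k + 1)))) fun ω => ?_)
      (lintegral_mono fun ω => ENNReal.ofReal_le_ofReal (hanti (slack_le_slack_succ _ _)))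
    refine Set.indicator_apply_le' (fun hω => ?_) fun _ => zero_le
    exact ENNReal.ofReal_le_ofReal (hanti (slack_succ_le (x := fun i => X i ω) hω))
  -- A first step below `-r` followed by a path of slack at most `r` keeps all iterated sums
  -- negative up to time `k + 1`.
  have h3 : ENNReal.ofReal q * P {ω | slack (fun i => X i ω) k ≤ r} ≤
      ENNReal.ofReal (p2 P X k) := by
    have hM : MeasurableSet {x : ℕ → ℝ | slack x k ≤ r} :=
      measurableSet_le (measurable_slack k) measurable_const
    have := h.mul_lintegral_le_of_first_step
      (g := {x : ℕ → ℝ | slack x k ≤ r}.indicator 1) (measurable_one.indicator hM) r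
    have e1 : ∫⁻ ω, {x : ℕ → ℝ | slack x k ≤ r}.indicator 1 (fun i => X i ω) ∂P =
      P {ω | slack (fun i => X i ω) k ≤ r} := lintegral_indicator_one hSm
    rw [e1] at this
    rw [hq, this]
    refine le_trans ?_ (ENNReal.ofReal_le_ofReal (p2_antitone P X (Nat.le_succ k)))
    have hM2 : MeasurableSet {ω | slack (fun i => X (i + 1) ω) k < -X 0 ω} := by
      have := h.slack_shift_measurable 1 k
      simp only [add_comm 1] at this
      exact measurableSet_lt this (h.measurable 0).neg
    rw [Nat.succ_eq_add_one, p2_succ_eq, ofReal_measureReal, ← lintegral_indicator_one hM2]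
    refine lintegral_mono fun ω => ?_
    refine Set.indicator_apply_le' (fun hω => ?_) fun _ => zero_le
    refine Set.indicator_apply_le' (fun hω' => ?_) fun _ => zero_le
    rw [Set.indicator_of_mem]
    · exact le_rfl
    · exact lt_of_le_of_lt (show slack (fun i => X (i + 1) ω) k ≤ r from hω') hω
  have hetop : e ≠ ⊤ := ne_top_of_le_ne_top ENNReal.one_ne_top he1
  have h4 : ENNReal.ofReal q * e ≤ ENNReal.ofReal (p2 P X k) + ENNReal.ofReal β * e := by
    calc ENNReal.ofReal q * e ≤ ENNReal.ofReal q *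
          (P {ω | slack (fun i => X i ω) k ≤ r} + ENNReal.ofReal β * I) := by gcongr
      _ = ENNReal.ofReal q * P {ω | slack (fun i => X i ω) k ≤ r} +
          ENNReal.ofReal β * (ENNReal.ofReal q * I) := by ring
      _ ≤ _ := by gcongr
  rw [← ENNReal.ofReal_toReal hetop] at h4 ⊢
  have ht0 : 0 ≤ e.toReal := ENNReal.toReal_nonneg
  have hp0 := p2_nonneg P X k
  rw [← ENNReal.ofReal_mul hq0.le, ← ENNReal.ofReal_mul hβ0.le,
    ← ENNReal.ofReal_add hp0 (by positivity), ENNReal.ofReal_le_ofReal_iff (by positivity)] at h4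
  refine ENNReal.ofReal_le_ofReal ?_
  rw [abs_of_pos (one_div_pos.2 (sub_pos.2 hβq)), one_div_mul_eq_div,
    le_div_iff₀ (sub_pos.2 hβq)]
  linarith

lemma lintegral_decayFun_slack_le (h : IsIID P X) {θ r : ℝ} (hr : 0 < r) (hθ : 1 / r < θ)
    (hq1 : lowerTail P (X 0) r < 1) (k : ℕ) :
    ∫⁻ ω, ENNReal.ofReal (decayFun P (X 0) θ r (slack (fun i => X i ω) k)) ∂P ≤
      ENNReal.ofReal
        ((1 + |1 / (lowerTail P (X 0) r - lowerTail P (X 0) r ^ (θ * r))|) * p2 P X k) := by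
  have hs := h.measurable_slack_path k
  have hp0 := p2_nonneg P X k
  calc _ = ∫⁻ ω, (ENNReal.ofReal (lowerTail P (X 0) (slack (fun i => X i ω) k)) +
        ENNReal.ofReal (expPart (lowerTail P (X 0) r) θ (slack (fun i => X i ω) k))) ∂P := by
        refine lintegral_congr fun t => ?_
        rw [decayFun, ENNReal.ofReal_add (lowerTail_nonneg _)
          (expPart_nonneg (lowerTail_nonneg _) _ _)]
    _ ≤ ENNReal.ofReal (p2 P X k) + ENNReal.ofReal
          (|1 / (lowerTail P (X 0) r - lowerTail P (X 0) r ^ (θ * r))| * p2 P X k) := by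
        rw [lintegral_add_left (f := fun ω =>
            ENNReal.ofReal (lowerTail P (X 0) (slack (fun i => X i ω) k)))
            (lowerTail_antitone.measurable.comp hs).ennreal_ofReal,
          h.lintegral_lowerTail_slack]
        exact add_le_add (ENNReal.ofReal_le_ofReal (p2_antitone P X (Nat.le_succ k)))
          (h.lintegral_expPart_slack_le hr hθ hq1 k)
    _ = _ := by
        rw [← ENNReal.ofReal_add hp0 (by positivity), add_mul, one_mul]

end IsIID

/-- The constant of the lower bounds. -/
noncomputable def lowerConst (K L θ r q : ℝ) : ℝ :=
  (|K| + |L| + 1) ^ 2 * (1 + |1 / (q - q ^ (θ * r))|) ^ 2 *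
    (1 + |1 / (θ * -Real.log q * r * q)|)

/-- The absolute values in the constant secure positivity for all real parameters, including
degenerate ones such as `q = 0`. -/
lemma lowerConst_pos (K L θ r q : ℝ) : 0 < lowerConst K L θ r q := by
  unfold lowerConst
  positivity

namespace IsIID

variable {Ω : Type*} [MeasurableSpace Ω] {P : Measure Ω} [IsProbabilityMeasure P]
  {X : ℕ → Ω → ℝ}

lemma lintegral_excess_le_lowerConst (h : IsIID P X) (hint : Integrable (X 0) P)
    (h0 : ∫ ω, X 0 ω ∂P = 0) {K L θ r : ℝ} (hD : DecayAssumption P (X 0) K L θ r) (k m : ℕ) :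
    ∫⁻ ω, ENNReal.ofReal (excess (fun i => X i ω) k m) ∂P ≤
      ENNReal.ofReal (lowerConst K L θ r (lowerTail P (X 0) r) * (p2 P X k * p2 P X m) *
        ((∫ ω, |X 0 ω| ∂P) / 2)) := by
  have hr := hD.1
  have hθ := hD.2.1
  have hθ0 : 0 < θ := (one_div_pos.2 hr).trans hθ
  have hm := h.measurable 0
  have hq1 := lowerTail_lt_one hint hm h0 hr
  set q := lowerTail P (X 0) r with hq
  set F := decayFun P (X 0) θ r with hF
  have hF0 : ∀ t, 0 ≤ F t := decayFun_nonneg θ r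
  have hFm : Measurable F := measurable_decayFun θ r
  set A := |K| + |L| + 1 with hA
  have hA0 : 0 ≤ A := by positivity
  set B := 1 + |1 / (q - q ^ (θ * r))| with hB
  have hB0 : 0 ≤ B := by positivity
  set C := 1 + |1 / (θ * -Real.log q * r * q)| with hC
  have hC0 : 0 ≤ C := by positivity
  set E := (∫ ω, |X 0 ω| ∂P) / 2 with hE
  have hE0 : 0 ≤ E := div_nonneg (integral_nonneg fun _ => abs_nonneg _) zero_le_two
  have eY : ∫⁻ ω, ENNReal.ofReal (-X 0 ω) ∂P = ENNReal.ofReal E := by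
    rw [lintegral_ofReal_of_integral_eq_zero hint.fun_neg (by rw [integral_neg, h0, neg_zero])]
    simp [hE]
  -- Two uses of submultiplicativity, on `u + v + t` and on `u + v`, give `A ^ 2`; the integral over
  -- `t` gives `C * E`. The square root shares the constant equally between the two factors.
  have hle : ∀ u v : ℝ, 0 ≤ u → 0 ≤ v → ∫⁻ ω, ENNReal.ofReal (-X 0 ω - u - v) ∂P ≤
      ENNReal.ofReal (√(A ^ 2 * C * E) * F u) * ENNReal.ofReal (√(A ^ 2 * C * E) * F v) := by
    intro u v hu hv
    simp only [sub_sub]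
    rw [lintegral_ofReal_neg_sub hm]
    calc _ ≤ ∫⁻ t in Set.Ioi 0, ENNReal.ofReal (A ^ 2 * (F u * F v)) * ENNReal.ofReal (F t) := by
          refine setLIntegral_mono' measurableSet_Ioi fun t ht => ?_
          have ht : 0 ≤ t := le_of_lt ht
          rw [← ENNReal.ofReal_mul (mul_nonneg (sq_nonneg _) (mul_nonneg (hF0 u) (hF0 v)))]
          refine ENNReal.ofReal_le_ofReal ?_
          calc lowerTail P (X 0) (u + v + t) ≤ F (u + v + t) :=
                le_add_of_nonneg_right (expPart_nonneg (lowerTail_nonneg _) _ _)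
            _ ≤ A * (F (u + v) * F t) := decayFun_add_le hD (by positivity) ht
            _ ≤ A * ((A * (F u * F v)) * F t) :=
                mul_le_mul_of_nonneg_left (mul_le_mul_of_nonneg_right
                  (decayFun_add_le hD hu hv) (hF0 t)) hA0
            _ = _ := by ring
      _ ≤ ENNReal.ofReal (A ^ 2 * (F u * F v)) * (ENNReal.ofReal C * ENNReal.ofReal E) := by
          rw [lintegral_const_mul' _ _ (by simp), ← eY]
          gcongr
          exact lintegral_decayFun_le hm hr hθ0 hq1
      _ = _ := by
          have hs := Real.mul_self_sqrt (by positivity : 0 ≤ A ^ 2 * C * E)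
          rw [← ENNReal.ofReal_mul hC0, ← ENNReal.ofReal_mul
            (mul_nonneg (sq_nonneg _) (mul_nonneg (hF0 u) (hF0 v))),
            ← ENNReal.ofReal_mul (mul_nonneg (Real.sqrt_nonneg _) (hF0 u))]
          congr 1
          linear_combination -(F u * F v) * hs
  refine (h.lintegral_excess_le k m (g := fun u => ENNReal.ofReal (√(A ^ 2 * C * E) * F u))
    (by fun_prop) hle).trans ?_
  have hj : ∀ j, ∫⁻ ω, ENNReal.ofReal (√(A ^ 2 * C * E) * F (slack (fun i => X i ω) j)) ∂P ≤
      ENNReal.ofReal (√(A ^ 2 * C * E) * (B * p2 P X j)) := by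
    intro j
    simp only [ENNReal.ofReal_mul (Real.sqrt_nonneg _)]
    rw [lintegral_const_mul' _ _ (by simp)]
    gcongr
    exact h.lintegral_decayFun_slack_le hr hθ hq1 j
  refine (mul_le_mul' (hj k) (hj m)).trans (le_of_eq ?_)
  have hk := p2_nonneg P X k
  rw [← ENNReal.ofReal_mul (by positivity)]
  congr 1
  have hs := Real.mul_self_sqrt (by positivity : 0 ≤ A ^ 2 * C * E)
  rw [lowerConst]
  linear_combination (B ^ 2 * p2 P X k * p2 P X m) * hs

lemma integral_abs_psum_le_mul_sum (h : IsIID P X) (hint : Integrable (X 0) P)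
    (h0 : ∫ ω, X 0 ω ∂P = 0) {K L θ r : ℝ} (hD : DecayAssumption P (X 0) K L θ r) (n : ℕ) :
    ∫ ω, |psum (fun i => X i ω) (n + 1)| ∂P ≤
      lowerConst K L θ r (lowerTail P (X 0) r) *
        (∑ k ∈ Finset.range (n + 1), p2 P X k * p2 P X (n - k)) * ∫ ω, |X 0 ω| ∂P := by
  set c := lowerConst K L θ r (lowerTail P (X 0) r) with hc
  have hc0 : 0 < c := lowerConst_pos _ _ _ _ _
  have hE0 : 0 ≤ ∫ ω, |X 0 ω| ∂P := integral_nonneg fun _ => abs_nonneg _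
  have hS0 : 0 ≤ ∑ k ∈ Finset.range (n + 1), p2 P X k * p2 P X (n - k) :=
    Finset.sum_nonneg fun k _ => mul_nonneg (p2_nonneg _ _ _) (p2_nonneg _ _ _)
  have e := lintegral_ofReal_of_integral_eq_zero (h.integrable_psum hint (n + 1)).fun_neg
    (by rw [integral_neg, h.integral_psum hint h0, neg_zero])
  simp only [abs_neg] at e
  have key : ENNReal.ofReal ((∫ ω, |psum (fun i => X i ω) (n + 1)| ∂P) / 2) ≤
      ENNReal.ofReal (c * (∑ k ∈ Finset.range (n + 1), p2 P X k * p2 P X (n - k)) *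
        ((∫ ω, |X 0 ω| ∂P) / 2)) := by
    rw [← e]
    calc _ ≤ ∫⁻ ω, ∑ k ∈ Finset.range (n + 1), volume (argmaxSet (fun i => X i ω) n k) ∂P :=
          lintegral_mono fun ω => le_sum_volume_argmaxSet _ n
      _ ≤ ∑ k ∈ Finset.range (n + 1), ENNReal.ofReal (c * (p2 P X k * p2 P X (n - k)) *
            ((∫ ω, |X 0 ω| ∂P) / 2)) := by
          rw [← h.sum_lintegral_excess]
          exact Finset.sum_le_sum fun k _ => h.lintegral_excess_le_lowerConst hint h0 hD k (n - k)
      _ = _ := by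
          rw [← ENNReal.ofReal_sum_of_nonneg fun k _ => mul_nonneg (mul_nonneg hc0.le
            (mul_nonneg (p2_nonneg _ _ _) (p2_nonneg _ _ _))) (by positivity),
            Finset.mul_sum, Finset.sum_mul]
  have := (ENNReal.ofReal_le_ofReal_iff (by positivity)).1 key
  linarith

end IsIID

end IteratedSums

namespace IteratedSums

/-! ### From convolution bounds to termwise bounds, and the main theorem -/

lemma sum_one_div_sqrt_le (n : ℕ) :
    ∑ k ∈ Finset.range n, 1 / √((k : ℝ) + 1) ≤ 2 * √(n : ℝ) := by
  induction n with
  | zero => simp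
  | succ n ih =>
    rw [Finset.sum_range_succ]
    refine (add_le_add_left ih _).trans ?_
    push_cast
    have h1 : 0 < √((n : ℝ) + 1) := Real.sqrt_pos.2 (by positivity)
    have h2 : √(n : ℝ) ≤ √((n : ℝ) + 1) := Real.sqrt_le_sqrt (by linarith)
    have h3 := Real.mul_self_sqrt (by positivity : (0 : ℝ) ≤ (n : ℝ) + 1)
    have h4 := Real.mul_self_sqrt (by positivity : (0 : ℝ) ≤ (n : ℝ))
    have h5 : 1 / √((n : ℝ) + 1) ≤ 2 * √((n : ℝ) + 1) - 2 * √(n : ℝ) := by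
      rw [div_le_iff₀ h1]
      nlinarith [sq_nonneg (√((n : ℝ) + 1) - √(n : ℝ))]
    linarith

/-- A bound on the convolution of two antitone sequences bounds the smaller one. -/
lemma le_of_sum_mul_le {p q : ℕ → ℝ} (hp : Antitone p) (hq : Antitone q) (hp0 : ∀ n, 0 ≤ p n)
    (hpq : ∀ n, p n ≤ q n) {c a : ℝ} (hc : 0 ≤ c) {n : ℕ}
    (h : ∑ k ∈ Finset.range (n + 1), p k * q (n - k) ≤ c ^ 2 * a) :
    p n ≤ c * √(a / ((n : ℝ) + 1)) := by
  have hn : (0 : ℝ) < (n : ℝ) + 1 := by positivity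
  have h1 : ((n : ℝ) + 1) * (p n * p n) ≤ c ^ 2 * a := by
    refine le_trans ?_ h
    calc ((n : ℝ) + 1) * (p n * p n) = ∑ _k ∈ Finset.range (n + 1), p n * p n := by
          simp
      _ ≤ _ := Finset.sum_le_sum fun k hk => by
          have := Finset.mem_range.1 hk
          exact mul_le_mul (hp (by omega)) ((hpq n).trans (hq (by omega))) (hp0 n) (hp0 k)
  have h2 : p n ^ 2 ≤ c ^ 2 * (a / ((n : ℝ) + 1)) := by
    rw [mul_div_assoc', le_div_iff₀ hn]
    linarith
  have h3 := Real.sqrt_le_sqrt h2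
  rwa [Real.sqrt_sq (hp0 n), Real.sqrt_mul (sq_nonneg c), Real.sqrt_sq hc] at h3

/-- Lower bounds on the self-convolution of an antitone sequence and upper bounds on its terms
give lower bounds on its terms. -/
lemma le_of_le_sum_mul {p a : ℕ → ℝ} (hp : Antitone p) (hp0 : ∀ n, 0 ≤ p n) (ha : Monotone a)
    (ha0 : ∀ n, 0 < a n) {c d : ℝ} (hc : 0 < c) (hd : 0 < d)
    (hle : ∀ n, p n ≤ c * √(a n / ((n : ℝ) + 1)))
    (h : ∀ n, 1 / d * a n ≤ ∑ k ∈ Finset.range (n + 1), p k * p (n - k)) (n : ℕ) :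
    1 / (4 * c * d) * √(a n / ((n : ℝ) + 1)) ≤ p n := by
  have hn : (0 : ℝ) < (n : ℝ) + 1 := by positivity
  -- At index `2 * n` one of `k` and `2 * n - k` is at least `n`, so every product has a factor at
  -- most `p n`, and the other index runs at most twice over `0, …, n`.
  have hsplit : ∑ k ∈ Finset.range (2 * n + 1), p k * p (2 * n - k) ≤
      2 * (p n * ∑ k ∈ Finset.range (n + 1), p k) := by
    have h1 : ∀ k ∈ Finset.range (n + 1), p k * p (2 * n - k) ≤ p n * p k := fun k hk => by
      have := Finset.mem_range.1 hk
      rw [mul_comm (p n)]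
      exact mul_le_mul_of_nonneg_left (hp (by omega)) (hp0 k)
    have h2 : ∑ k ∈ Finset.range n, p (n + 1 + k) * p (2 * n - (n + 1 + k)) ≤
        p n * ∑ k ∈ Finset.range (n + 1), p k := by
      rw [Finset.mul_sum, ← Finset.sum_range_reflect, Finset.sum_range_succ]
      refine le_add_of_le_of_nonneg (Finset.sum_le_sum fun k hk => ?_)
        (mul_nonneg (hp0 _) (hp0 _))
      have := Finset.mem_range.1 hk
      rw [show 2 * n - (n + 1 + (n - 1 - k)) = k by omega]
      exact mul_le_mul_of_nonneg_right (hp (by omega)) (hp0 k)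
    rw [show 2 * n + 1 = (n + 1) + n by ring, Finset.sum_range_add, two_mul (p n * _)]
    refine add_le_add ?_ h2
    rw [Finset.mul_sum]
    exact Finset.sum_le_sum h1
  have hsum : ∑ k ∈ Finset.range (n + 1), p k ≤ c * √(a n) * (2 * √((n : ℝ) + 1)) := by
    have := sum_one_div_sqrt_le (n + 1)
    push_cast at this
    refine le_trans ?_ (mul_le_mul_of_nonneg_left this (by positivity))
    rw [Finset.mul_sum]
    refine Finset.sum_le_sum fun k hk => (hle k).trans ?_
    have := Finset.mem_range.1 hk
    rw [Real.sqrt_div (ha0 k).le, mul_one_div, ← mul_div_assoc]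
    gcongr
    exact ha (by omega)
  have h1 : 1 / d * a n ≤ 2 * (p n * (c * √(a n) * (2 * √((n : ℝ) + 1)))) :=
    calc 1 / d * a n ≤ 1 / d * a (2 * n) :=
          mul_le_mul_of_nonneg_left (ha (by omega)) (by positivity)
      _ ≤ _ := (h (2 * n)).trans hsplit
      _ ≤ _ := by
          gcongr
          exact hp0 n
  have hs : 0 < √(a n) := Real.sqrt_pos.2 (ha0 n)
  have hm : 0 < √((n : ℝ) + 1) := Real.sqrt_pos.2 hn
  have hsq := Real.mul_self_sqrt (ha0 n).le
  rw [Real.sqrt_div (ha0 n).le, one_div_mul_eq_div, div_div, div_le_iff₀ (by positivity)]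
  rw [one_div_mul_eq_div, div_le_iff₀ hd] at h1
  nth_rewrite 1 [← hsq] at h1
  refine le_of_mul_le_mul_right ?_ hs
  linarith

namespace IsIID

variable {Ω : Type*} [MeasurableSpace Ω] {P : Measure Ω} [IsProbabilityMeasure P]
  {X : ℕ → Ω → ℝ}

lemma sum_p2_mul_p2bar_le (h : IsIID P X) (hint : Integrable (X 0) P)
    (h0 : ∫ ω, X 0 ω ∂P = 0) (hpos : 0 < ∫ ω, |X 0 ω| ∂P) {c : ℝ}
    (hc : c = 6 * √30 ∨ (SymmetricLaw P (X 0) ∧ c = 2)) (n : ℕ) :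
    ∑ k ∈ Finset.range (n + 1), p2 P X k * p2bar P X (n - k) ≤
      c ^ 2 * ((∫ ω, |psum (fun i => X i ω) (n + 1)| ∂P) / ∫ ω, |X 0 ω| ∂P) := by
  have hA : 0 ≤ ∫ ω, |psum (fun i => X i ω) (n + 1)| ∂P := integral_nonneg fun _ => abs_nonneg _
  have h1 : (∑ k ∈ Finset.range (n + 1), p2bar P X k * p2bar P X (n - k)) * ∫ ω, |X 0 ω| ∂P ≤
      c ^ 2 * ∫ ω, |psum (fun i => X i ω) (n + 1)| ∂P := by
    rcases hc with rfl | ⟨hs, rfl⟩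
    · refine (h.sum_p2bar_mul_le_general hint h0 hpos n).trans ?_
      -- Here `c ^ 2 = 1080`, well above the `12` that the argument yields.
      rw [mul_pow, Real.sq_sqrt (by norm_num)]
      gcongr
      norm_num
    · refine (h.sum_p2bar_mul_le_of_symmetric hint h0 hs n).trans ?_
      gcongr
      norm_num
  rw [mul_div_assoc', le_div_iff₀ hpos]
  refine le_trans (mul_le_mul_of_nonneg_right (Finset.sum_le_sum fun k _ => ?_) hpos.le) h1
  exact mul_le_mul_of_nonneg_right (p2_le_p2bar P X k) (p2bar_nonneg P X _)

end IsIID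

end IteratedSums

theorem theorem1 :
    ∃ c₂ : ℝ → ℝ → ℝ → ℝ → ℝ → ℝ, (∀ K L θ r q : ℝ, 0 < c₂ K L θ r q) ∧
      ∀ (Ω : Type*) [MeasurableSpace Ω] (P : Measure Ω) [IsProbabilityMeasure P]
        (X : ℕ → Ω → ℝ), (∀ i, Measurable (X i)) → iIndepFun X P →
        (∀ i, IdentDistrib (X i) (X 0) P P) → Integrable (X 0) P →
        ∫ ω, X 0 ω ∂P = 0 → 0 < ∫ ω, |X 0 ω| ∂P →
        ∀ c₁ : ℝ, (c₁ = 6 * √30 ∨ (IteratedSums.SymmetricLaw P (X 0) ∧ c₁ = 2)) →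
          (∀ n : ℕ,
            ∑ k ∈ Finset.range (n + 1), IteratedSums.p2 P X k * IteratedSums.p2bar P X (n - k) ≤
              c₁ ^ 2 * ((∫ ω, |IteratedSums.S X (n + 1) ω| ∂P) / ∫ ω, |X 0 ω| ∂P)) ∧
          (∀ n : ℕ,
            IteratedSums.p2 P X n ≤
              c₁ * √((∫ ω, |IteratedSums.S X (n + 1) ω| ∂P) /
                (((n : ℝ) + 1) * ∫ ω, |X 0 ω| ∂P))) ∧
          (∀ K L θ r : ℝ, IteratedSums.DecayAssumption P (X 0) K L θ r →
            (∀ n : ℕ,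
              1 / c₂ K L θ r (IteratedSums.lowerTail P (X 0) r) *
                  ((∫ ω, |IteratedSums.S X (n + 1) ω| ∂P) / ∫ ω, |X 0 ω| ∂P) ≤
                ∑ k ∈ Finset.range (n + 1),
                  IteratedSums.p2 P X k * IteratedSums.p2 P X (n - k)) ∧
            (∀ n : ℕ,
              1 / (4 * c₁ * c₂ K L θ r (IteratedSums.lowerTail P (X 0) r)) *
                  √((∫ ω, |IteratedSums.S X (n + 1) ω| ∂P) /
                    (((n : ℝ) + 1) * ∫ ω, |X 0 ω| ∂P)) ≤
                IteratedSums.p2 P X n)) := by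
  refine ⟨IteratedSums.lowerConst, IteratedSums.lowerConst_pos, ?_⟩
  intro Ω _ P _ X hm hind hid hint h0 hpos c₁ hc
  have h : IteratedSums.IsIID P X := ⟨hm, hind, hid⟩
  have hc0 : 0 < c₁ := by
    rcases hc with rfl | ⟨_, rfl⟩ <;> positivity
  set a : ℕ → ℝ := fun n => (∫ ω, |IteratedSums.S X (n + 1) ω| ∂P) / ∫ ω, |X 0 ω| ∂P with ha
  have hmono : Monotone a := fun i j hij =>
    div_le_div_of_nonneg_right
      (h.monotone_integral_abs_psum hint h0 (Nat.add_le_add_right hij 1)) hpos.le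
  have ha0 : ∀ n, 0 < a n := fun n =>
    div_pos (hpos.trans_le (h.integral_abs_le_integral_abs_psum hint h0 n)) hpos
  have e : ∀ n : ℕ, (∫ ω, |IteratedSums.S X (n + 1) ω| ∂P) /
      (((n : ℝ) + 1) * ∫ ω, |X 0 ω| ∂P) = a n / ((n : ℝ) + 1) := fun n => by
    rw [ha, div_div, mul_comm]
  have hU : ∀ n, ∑ k ∈ Finset.range (n + 1),
      IteratedSums.p2 P X k * IteratedSums.p2bar P X (n - k) ≤ c₁ ^ 2 * a n :=
    h.sum_p2_mul_p2bar_le hint h0 hpos hc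
  have hp := IteratedSums.p2_antitone P X
  have hp0 := IteratedSums.p2_nonneg P X
  have hP : ∀ n, IteratedSums.p2 P X n ≤ c₁ * √(a n / ((n : ℝ) + 1)) := fun n =>
    IteratedSums.le_of_sum_mul_le hp (IteratedSums.p2bar_antitone P X) hp0
      (IteratedSums.p2_le_p2bar P X) hc0.le (hU n)
  simp only [e]
  refine ⟨hU, hP, fun K L θ r hD => ?_⟩
  have hd := IteratedSums.lowerConst_pos K L θ r (IteratedSums.lowerTail P (X 0) r)
  have hL : ∀ n, 1 / IteratedSums.lowerConst K L θ r (IteratedSums.lowerTail P (X 0) r) * a n ≤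
      ∑ k ∈ Finset.range (n + 1), IteratedSums.p2 P X k * IteratedSums.p2 P X (n - k) := by
    intro n
    rw [one_div_mul_eq_div, div_le_iff₀ hd, div_le_iff₀ hpos, mul_comm (Finset.sum _ _)]
    exact h.integral_abs_psum_le_mul_sum hint h0 hD n
  exact ⟨hL, IteratedSums.le_of_le_sum_mul hp hp0 hmono ha0 hc0 hd hP hL⟩
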